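/- **Setting.** Let $h:\mathbb{R}^{d_x}\to\mathbb{R}$, $c:\mathbb{R}^{d_x}\to\mathbb{R}^{d_y}$, $f(x,y)=h(x)+y^{T}c(x)$, $\mathcal{Y}=\{y\in\mathbb{R}^{d_y}: 0\le y\le\overline{y}\}$ and $\Phi(x)=\max_{y\in\mathcal{Y}}f(x,y)$. Suppose that $\Phi(x)\ge\underline{f}$ for all $x$ and some finite $\underline{f}$, that $f(\cdot,y)$ is differentiable for every $y\in\mathcal Y$, and that, for some $L>0$, $\|\nabla f(x_1,y_1)-\nabla f(x_2,y_2)\|\le L(\|x_1-x_2\|+\|y_1-y_2\|)$ for all $x_1,x_2\in\mathbb{R}^{d_x}$, $y_1,y_2\in\mathcal{Y}$, where $\nabla f=(\nabla_xf,\nabla_yf)$ and $\nabla_y f(x,y)=c(x)$. A query at $x$ returns $h(x)$ and $c(x)$. **Algorithm (ZOB-SGDA).** Given a block size $b\in\{1,\dots,d_x\}$, numbers $p,\alpha,\beta,\gamma$, radii $r_k>0$, a starting point $(x_0,y_0)\in\mathbb{R}^{d_x}\times\mathcal{Y}$ and $z_0=x_0$, draw independent sets $\mathcal{I}_k\subseteq\{1,\dots,d_x\}$,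 uniform among those of size $b$, and for $k=0,1,2,\dots$ put $$x_{k+1}=x_k-\alpha\sum_{i\in\mathcal{I}_k}\Big(\tfrac{f(x_k+r_ke_i,y_k)-f(x_k,y_k)}{r_k}+p\,(x_k-z_k)(i)\Big)e_i,$$ $$y_{k+1}=\mathcal{P}_{\mathcal{Y}}[y_k+\beta\,c(x_k)],\qquad z_{k+1}=\gamma x_{k+1}+(1-\gamma)z_k.$$ Step $k$ queries the point $x_k$ and the points $x_k+r_ke_i$, $i\in\mathcal{I}_k$. The stationarity measure is $$\mathfrak{g}(x,y)=\Big(\nabla_xf(x,y),\ \tfrac1\beta\big(y-\mathcal{P}_{\mathcal{Y}}[y+\beta\nabla_yf(x,y)]\big)\Big).$$ **Statement.** Write $N=d_x/b$. Let $L>0$, $p\ge 3L$, $0<\alpha\le\frac{1}{p+10L+1}$, $\theta>0$ and $R,\Delta,G$ be given. There is $a_0>0$, depending only on $(L,p,\alpha,\theta,R,\Delta,G)$, such that for every $a\in(0,a_0]$ there are $C,\varepsilon_0>0$, depending only on these numbers and on $a$ (in particular not on $d_x$, $d_y$, $b$ or $\varepsilon$), for which the following holds. For all $1\le b\le d_x$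 and $0<\varepsilon\le\varepsilon_0$, with $\gamma=a\,\varepsilon^2/N$, there is a number of steps $K\ge1$, depending only on these constants and on $d_x,b,\varepsilon$, such that for every problem as above (any $d_y$) with $\|\overline{y}\|\le R$, every starting point with $\Phi(x_0)-\underline{f}\le\Delta$, $\Phi(x_0)-f(x_0,y_0)\le\Delta$, $\|\nabla_xf(x_0,y_0)\|\le G$, every $\beta$ with $$\frac{\theta}{N}\le\beta\le\min\Big\{\frac1{12L},\ \frac{\alpha^2(p-L)^2}{4L(\sqrt N+\alpha(p-L))^2}\Big\},$$ and all radii $r_k>0$ with $\sum_{k=0}^{K}r_k^2\le\frac1b$: 1. $\gamma\le\min\big\{\sqrt{\tfrac{1}{KN}},\ \tfrac1{36},\ \tfrac{1}{768p\beta}\big\}$; 2. the first $K$ steps use at most $C\,d_x/\varepsilon^4$ queries; 3. $\min_{k\le K-1}\mathbb{E}\big[\|\mathfrak{g}(x_k,y_k)\|\big]\le\varepsilon$. -/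

import Mathlib

open MeasureTheory ProbabilityTheory

noncomputable section

namespace ZOBSGDA

/-- `ℝⁿ` with the Euclidean norm. -/
abbrev Vec (n : ℕ) := EuclideanSpace ℝ (Fin n)

variable {dx dy : ℕ}

/-- The Lagrange function `f(x,y) = h(x) + yᵀ c(x)`. -/
def lagrangian (h : Vec dx → ℝ) (c : Vec dx → Vec dy) (x : Vec dx) (y : Vec dy) : ℝ :=
  h x + inner ℝ y (c x)

/-- The dual feasible set `𝒴 = {y | 0 ≤ y ≤ ȳ}`. -/
def dualBox (ybar : Vec dy) : Set (Vec dy) :=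
  {y | ∀ j, 0 ≤ y j ∧ y j ≤ ybar j}

/-- `Φ(x) = max_{y ∈ 𝒴} f(x,y)`. -/
def primalMax (h : Vec dx → ℝ) (c : Vec dx → Vec dy) (ybar : Vec dy) (x : Vec dx) : ℝ :=
  sSup (lagrangian h c x '' dualBox ybar)

/-- The partial gradient `∇ₓ f(x,y)`. -/
def gradX (h : Vec dx → ℝ) (c : Vec dx → Vec dy) (x : Vec dx) (y : Vec dy) : Vec dx :=
  gradient (fun u => lagrangian h c u y) x

/-- The partial gradient `∇_y f(x,y)`. -/
def gradY (h : Vec dx → ℝ) (c : Vec dx → Vec dy) (x : Vec dx) (y : Vec dy) : Vec dy :=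
  gradient (fun v => lagrangian h c x v) y

/-- The dual gradient is the observed constraint value. -/
theorem gradY_eq (h : Vec dx → ℝ) (c : Vec dx → Vec dy) (x : Vec dx) (y : Vec dy) :
    gradY h c x y = c x := by
  unfold gradY lagrangian
  apply HasGradientAt.gradient
  rw [hasGradientAt_iff_hasFDerivAt]
  have h1 : HasFDerivAt (fun v : Vec dy => (InnerProductSpace.toDual ℝ (Vec dy) (c x)) v)
      (InnerProductSpace.toDual ℝ (Vec dy) (c x)) y :=
    ContinuousLinearMap.hasFDerivAt _
  have h2 := h1.const_add (h x)
  refine h2.congr_of_eventuallyEq (Filter.Eventually.of_forall fun v => ?_)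
  simp [InnerProductSpace.toDual_apply_apply, real_inner_comm]

/-- `f` is differentiable and `L`-smooth on `ℝ^{dx} × 𝒴`:
`‖∇f(x₁,y₁) - ∇f(x₂,y₂)‖ ≤ L (‖x₁ - x₂‖ + ‖y₁ - y₂‖)`, where `∇f = (∇ₓ f, ∇_y f)`. -/
structure IsSmooth (L : ℝ) (h : Vec dx → ℝ) (c : Vec dx → Vec dy) (ybar : Vec dy) : Prop where
  differentiable : ∀ y ∈ dualBox ybar, Differentiable ℝ (fun x => lagrangian h c x y)
  lipschitz : ∀ x₁ x₂ : Vec dx, ∀ y₁ ∈ dualBox ybar, ∀ y₂ ∈ dualBox ybar,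
    ‖WithLp.toLp 2 (gradX h c x₁ y₁ - gradX h c x₂ y₂, gradY h c x₁ y₁ - gradY h c x₂ y₂)‖
      ≤ L * (‖x₁ - x₂‖ + ‖y₁ - y₂‖)

/-- The Euclidean projection onto `𝒴`, in coordinates (see `projBox_mem` and
`norm_sub_projBox_le`). -/
def projBox (ybar : Vec dy) (y : Vec dy) : Vec dy :=
  WithLp.toLp 2 (fun j => max 0 (min (y j) (ybar j)))

theorem projBox_mem {ybar w : Vec dy} (hw : w ∈ dualBox ybar) (y : Vec dy) :
    projBox ybar y ∈ dualBox ybar := fun j =>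
  ⟨le_max_left _ _, max_le ((hw j).1.trans (hw j).2) (min_le_right _ _)⟩

/-- `projBox ybar y` is a nearest point of `𝒴` to `y`. -/
theorem norm_sub_projBox_le {ybar w : Vec dy} (hw : w ∈ dualBox ybar) (y : Vec dy) :
    ‖y - projBox ybar y‖ ≤ ‖y - w‖ := by
  rw [EuclideanSpace.norm_eq, EuclideanSpace.norm_eq]
  apply Real.sqrt_le_sqrt
  refine Finset.sum_le_sum fun j _ => ?_
  obtain ⟨h1, h2⟩ := hw j
  simp only [PiLp.sub_apply, projBox, Real.norm_eq_abs, sq_abs]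
  rcases le_total (y j) (ybar j) with h3 | h3
  · rw [min_eq_left h3]
    rcases le_total 0 (y j) with h4 | h4
    · rw [max_eq_right h4]; nlinarith [sq_nonneg (y j - w j)]
    · rw [max_eq_left h4]; nlinarith
  · rw [min_eq_right h3, max_eq_right (h1.trans h2)]; nlinarith

/-- The stationarity measure
`𝔤(x,y) = (∇ₓ f(x,y), (1/β)(y - P_𝒴[y + β ∇_y f(x,y)]))`, in the Euclidean product space. -/
def proxGrad (h : Vec dx → ℝ) (c : Vec dx → Vec dy) (ybar : Vec dy) (β : ℝ)
    (x : Vec dx) (y : Vec dy) : WithLp 2 (Vec dx × Vec dy) :=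
  WithLp.toLp 2
    (gradX h c x y, (1 / β) • (y - projBox ybar (y + β • gradY h c x y)))

/-- The standard basis vector `eᵢ`. -/
def basisVec (i : Fin dx) : Vec dx := EuclideanSpace.single i 1

/-- The block gradient estimator
`∑_{i ∈ I} ((f(x + r eᵢ, y) - f(x,y)) / r · eᵢ + p (x - z) ⊙ eᵢ)` of the smoothed function. -/
def blockEstimator (h : Vec dx → ℝ) (c : Vec dx → Vec dy) (p r : ℝ) (I : Finset (Fin dx))
    (x : Vec dx) (y : Vec dy) (z : Vec dx) : Vec dx :=
  ∑ i ∈ I,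
    ((lagrangian h c (x + r • basisVec i) y - lagrangian h c x y) / r + p * (x i - z i))
      • basisVec i

/-- The iterates `(x, y, z)` of the algorithm. -/
structure State (dx dy : ℕ) where
  x : Vec dx
  y : Vec dy
  z : Vec dx

/-- One step of ZOB-SGDA with sampled block `I` and smoothing radius `r`. The dual step uses the
observed value `c x`, which is `∇_y f(x,y)` by `gradY_eq`. -/
def step (h : Vec dx → ℝ) (c : Vec dx → Vec dy) (ybar : Vec dy) (p α β γ r : ℝ)
    (I : Finset (Fin dx)) (s : State dx dy) : State dx dy :=
  let xNew := s.x - α • blockEstimator h c p r I s.x s.y s.z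
  { x := xNew
    y := projBox ybar (s.y + β • c s.x)
    z := γ • xNew + (1 - γ) • s.z }

/-- The run of ZOB-SGDA from `(x₀, y₀)`, `z₀ = x₀`, along the blocks `I 0, I 1, …`. -/
def iterate (h : Vec dx → ℝ) (c : Vec dx → Vec dy) (ybar : Vec dy) (p α β γ : ℝ) (r : ℕ → ℝ)
    (x₀ : Vec dx) (y₀ : Vec dy) (I : ℕ → Finset (Fin dx)) : ℕ → State dx dy
  | 0 => ⟨x₀, y₀, x₀⟩
  | k + 1 => step h c ybar p α β γ (r k) (I k) (iterate h c ybar p α β γ r x₀ y₀ I k)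

/-- The points at which the black box `x ↦ (h x, c x)` is queried in one step: `x` itself and
`x + r eᵢ` for `i ∈ I`, counted with multiplicity. -/
def stepQueries (r : ℝ) (I : Finset (Fin dx)) (x : Vec dx) : Multiset (Vec dx) :=
  x ::ₘ I.val.map (fun i => x + r • basisVec i)

/-- The number of black-box queries in the first `K` steps of ZOB-SGDA. -/
def queryCount (h : Vec dx → ℝ) (c : Vec dx → Vec dy) (ybar : Vec dy) (p α β γ : ℝ) (r : ℕ → ℝ)
    (x₀ : Vec dx) (y₀ : Vec dy) (I : ℕ → Finset (Fin dx)) (K : ℕ) : ℕ :=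
  ∑ k ∈ Finset.range K,
    (stepQueries (r k) (I k) (iterate h c ybar p α β γ r x₀ y₀ I k).x).card

/-- The blocks `I 0, I 1, …` are independent, each uniformly distributed on the subsets of
`{1, …, dx}` of size `b`. -/
structure IsBlockSampling {Ω : Type*} [MeasurableSpace Ω] (P : Measure Ω) (b : ℕ)
    (I : ℕ → Ω → Finset (Fin dx)) : Prop where
  measurable : ∀ k, Measurable[_, ⊤] (I k)
  card_eq : ∀ k ω, (I k ω).card = b
  uniform : ∀ k, ∀ S : Finset (Fin dx), S.card = b →
    P.real {ω | I k ω = S} = 1 / (dx.choose b : ℝ)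
  indep : iIndepFun (m := fun _ => (⊤ : MeasurableSpace (Finset (Fin dx)))) I P

end ZOBSGDA

end

/-! The argument is a Lyapunov analysis of a smoothed gradient descent-ascent. Write K(x, z; y) =
f(x, y) + p/2 ‖x - z‖², which is (p - L)-strongly convex in x. The potential V = K - 2 min_u K(u, z;
y) + 2 min_u (Φ(u) + p/2 ‖u - z‖²) is bounded below by any lower bound of Φ (`le_potential`), and
since z₀ = x₀ its initial value is controlled by Δ and G (`potential_init_le`).

Along one step (`potential_step_le`) three effects combine. The block step lowers K by a multiple of
the squared sampled gradient coordinates. The projected dual step gives -‖y' - y‖²/β up to Lipschitz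
errors. The averaging step gives a multiple of -γ‖x' - z‖², but also a cross term with the distance
E from the minimizer of K(·, z; y') to the proximal point of Φ. Only E², not E, is linearly bounded
by the dual displacement and the gradient of K (`sq_norm_sub_prox_le`, through the duality gap on a
box of diameter at most R). Young's inequality therefore leaves a residual of order Nγ² per step
(`step_scalar_bound`), and this residual dictates the rate.

The sampled sum of squares has conditional mean ‖∇ₓK‖²/N, because the next block is independent of
the current iterate (`integral_sum_block`). Summing over K steps and taking expectations bounds Σ
E‖𝔤‖² by a constant times N + 1/γ, provided K N γ² ≤ 1 (`sum_integral_norm_sq_proxGrad_le`). With γ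
= aε²/N and K ≈ N/(aε²)² the average of E‖𝔤‖² is O(aε²), which is at most ε² for small a; K steps
cost K(b + 1) = O(d_x/ε⁴) queries. -/

noncomputable section

/-! ### Strong convexity and the descent lemma. -/

section Smooth

variable {E : Type*} [NormedAddCommGroup E] [InnerProductSpace ℝ E]

/-- The first-order form of `m`-strong convexity, for a function `K` with gradient field `g`. -/
def StrongFirstOrder (m : ℝ) (K : E → ℝ) (g : E → E) : Prop :=
  ∀ u v, K v + inner ℝ (g v) (u - v) + m / 2 * ‖u - v‖ ^ 2 ≤ K u

namespace StrongFirstOrder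

variable {m : ℝ} {K : E → ℝ} {g : E → E} {X : E}

theorem quadratic_growth (hK : StrongFirstOrder m K g) (hX : g X = 0) (u : E) :
    K X + m / 2 * ‖u - X‖ ^ 2 ≤ K u := by
  simpa [hX] using hK u X

/-- Adding the inequalities based at `X` and at `u` gives m‖u - X‖² ≤ ⟪g u, u - X⟫; then
Cauchy–Schwarz. -/
theorem mul_norm_sub_le (hK : StrongFirstOrder m K g) (hX : g X = 0) (u : E) :
    m * ‖u - X‖ ≤ ‖g u‖ := by
  rcases (norm_nonneg (u - X)).eq_or_lt with h0 | h0
  · rw [← h0, mul_zero]; exact norm_nonneg _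
  have h1 := hK.quadratic_growth hX u
  have h2 := hK X u
  rw [norm_sub_rev X u] at h2
  have h3 := abs_real_inner_le_norm (g u) (X - u)
  rw [norm_sub_rev X u] at h3
  have h4 := neg_abs_le (inner ℝ (g u) (X - u))
  refine le_of_mul_le_mul_right ?_ h0
  nlinarith

/-- The Polyak–Łojasiewicz inequality: minimize the quadratic lower bound at `u` over all
displacements. -/
theorem sub_le_norm_sq (hK : StrongFirstOrder m K g) (hm : 0 < m) (u v : E) :
    K u - K v ≤ ‖g u‖ ^ 2 / (2 * m) := by
  have h2 := hK v u
  have h3 := abs_real_inner_le_norm (g u) (v - u)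
  have h4 := neg_abs_le (inner ℝ (g u) (v - u))
  rw [le_div_iff₀ (by positivity)]
  nlinarith [sq_nonneg (‖g u‖ - m * ‖v - u‖)]

theorem exists_forall_le [ProperSpace E] (hK : StrongFirstOrder m K g) (hm : 0 < m)
    (hc : Continuous K) : ∃ X, ∀ u, K X ≤ K u := by
  refine hc.exists_forall_le_of_isBounded 0 ?_
  refine (Metric.isBounded_closedBall (x := (0 : E)) (r := 2 * ‖g 0‖ / m)).subset fun u hu => ?_
  rw [mem_closedBall_zero_iff, le_div_iff₀ hm]
  have h1 : K u ≤ K 0 := hu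
  have h2 := hK u 0
  rw [sub_zero] at h2
  have h3 := abs_real_inner_le_norm (g 0) u
  have h4 := neg_abs_le (inner ℝ (g 0) u)
  rcases (norm_nonneg u).eq_or_lt with h0 | h0
  · rw [← h0, zero_mul]; positivity
  · refine le_of_mul_le_mul_right ?_ h0
    nlinarith

end StrongFirstOrder

/-- Adding `p / 2 * ‖· - z‖ ^ 2` to a function that is bounded below by its first-order expansion
minus `L / 2 * ‖u - v‖ ^ 2` makes it `(p - L)`-strongly convex. -/
theorem strongFirstOrder_add_sq {f : E → ℝ} {f' : E → E} {L : ℝ}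
    (hf : ∀ u v, f v + inner ℝ (f' v) (u - v) - L / 2 * ‖u - v‖ ^ 2 ≤ f u) (p : ℝ) (z : E) :
    StrongFirstOrder (p - L) (fun u => f u + p / 2 * ‖u - z‖ ^ 2)
      (fun u => f' u + p • (u - z)) := by
  intro u v
  have h := hf u v
  have h1 : ‖u - z‖ ^ 2 = ‖v - z‖ ^ 2 + 2 * inner ℝ (v - z) (u - v) + ‖u - v‖ ^ 2 := by
    rw [← norm_add_sq_real]; congr 2; abel
  simp only [inner_add_left, inner_smul_left, h1, RCLike.conj_to_real]
  linarith

variable [CompleteSpace E]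

/-- The descent lemma: a function with `L`-Lipschitz gradient is bounded above by its first-order
expansion plus `L / 2 * ‖u - v‖ ^ 2`. -/
theorem HasGradientAt.le_add_inner_add_sq {f : E → ℝ} {f' : E → E} {L : ℝ}
    (hf : ∀ x, HasGradientAt f (f' x) x) (hL : ∀ x y, ‖f' x - f' y‖ ≤ L * ‖x - y‖) (u v : E) :
    f u ≤ f v + inner ℝ (f' v) (u - v) + L / 2 * ‖u - v‖ ^ 2 := by
  set w := u - v with hw
  have hd : ∀ t : ℝ, HasDerivAt
      (fun t : ℝ => f (v + t • w) - t * inner ℝ (f' v) w - L / 2 * t ^ 2 * ‖w‖ ^ 2)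
      (inner ℝ (f' (v + t • w)) w - inner ℝ (f' v) w - L * t * ‖w‖ ^ 2) t := by
    intro t
    have h1 : HasDerivAt (fun t : ℝ => v + t • w) w t := by
      simpa using ((hasDerivAt_id t).smul_const w).const_add v
    have h2 := (hf (v + t • w)).hasFDerivAt.comp_hasDerivAt t h1
    have h3 : HasDerivAt (fun t : ℝ => t * inner ℝ (f' v) w) (inner ℝ (f' v) w) t := by
      simpa using (hasDerivAt_id t).mul_const (inner ℝ (f' v) w)
    have h4 : HasDerivAt (fun t : ℝ => L / 2 * t ^ 2 * ‖w‖ ^ 2) (L * t * ‖w‖ ^ 2) t := by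
      refine ((((hasDerivAt_id t).pow 2).const_mul (L / 2)).mul_const (‖w‖ ^ 2)).congr_deriv ?_
      simp only [id_eq]; ring
    refine ((h2.sub h3).sub h4).congr_deriv ?_
    simp [InnerProductSpace.toDual_apply_apply]
  -- By the Lipschitz bound this function of `t` has nonpositive derivative on (0, 1); its values at
  -- 0 and 1 give the claim.
  have hanti : AntitoneOn
      (fun t : ℝ => f (v + t • w) - t * inner ℝ (f' v) w - L / 2 * t ^ 2 * ‖w‖ ^ 2)
      (Set.Icc 0 1) := by
    refine antitoneOn_of_deriv_nonpos (convex_Icc 0 1)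
      (fun t _ => (hd t).continuousAt.continuousWithinAt)
      (fun t _ => (hd t).differentiableAt.differentiableWithinAt) fun t ht => ?_
    rw [interior_Icc] at ht
    rw [(hd t).deriv, ← inner_sub_left]
    have h1 := real_inner_le_norm (f' (v + t • w) - f' v) w
    have h2 := hL (v + t • w) v
    rw [add_sub_cancel_left, norm_smul, Real.norm_eq_abs, abs_of_pos ht.1] at h2
    nlinarith [mul_le_mul_of_nonneg_right h2 (norm_nonneg w)]
  have h := hanti (Set.left_mem_Icc.2 zero_le_one) (Set.right_mem_Icc.2 zero_le_one) zero_le_one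
  have h5 : v + w = u := by rw [hw]; abel
  simp only [one_smul, zero_smul, add_zero, h5] at h
  nlinarith

theorem HasGradientAt.add_inner_sub_sq_le {f : E → ℝ} {f' : E → E} {L : ℝ}
    (hf : ∀ x, HasGradientAt f (f' x) x) (hL : ∀ x y, ‖f' x - f' y‖ ≤ L * ‖x - y‖) (u v : E) :
    f v + inner ℝ (f' v) (u - v) - L / 2 * ‖u - v‖ ^ 2 ≤ f u := by
  have hf' : ∀ x, HasGradientAt (fun x => -f x) (-f' x) x := fun x => by
    have := (hf x).hasFDerivAt.neg
    rw [hasGradientAt_iff_hasFDerivAt, map_neg]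
    exact this
  have h := HasGradientAt.le_add_inner_add_sq hf' (L := L)
    (fun x y => by rw [← neg_sub', norm_neg]; exact hL x y) u v
  rw [inner_neg_left] at h
  linarith

theorem HasGradientAt.eq_zero_of_forall_le {f : E → ℝ} {g x : E} (hf : HasGradientAt f g x)
    (hmin : ∀ u, f x ≤ f u) : g = 0 := by
  have h : IsLocalMin f x := Filter.Eventually.of_forall hmin
  have := h.hasFDerivAt_eq_zero hf.hasFDerivAt
  simpa using this

theorem HasGradientAt.add_sq {f : E → ℝ} {g x : E} (hf : HasGradientAt f g x) (p : ℝ) (z : E) :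
    HasGradientAt (fun u => f u + p / 2 * ‖u - z‖ ^ 2) (g + p • (x - z)) x := by
  rw [hasGradientAt_iff_hasFDerivAt] at hf ⊢
  have h1 : HasFDerivAt (fun u : E => u - z) (ContinuousLinearMap.id ℝ E) x :=
    (hasFDerivAt_id x).sub_const z
  refine (hf.add ((h1.norm_sq).const_mul (p / 2))).congr_fderiv ?_
  ext u
  simp [InnerProductSpace.toDual_apply_apply]
  ring

end Smooth

namespace ZOBSGDA

variable {dx dy : ℕ}

/-! ### The dual box and its projection. -/

section Box

variable {ybar y w : Vec dy}

theorem norm_sub_le_of_mem_dualBox (hy : y ∈ dualBox ybar) (hw : w ∈ dualBox ybar) :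
    ‖w - y‖ ≤ ‖ybar‖ := by
  rw [EuclideanSpace.norm_eq, EuclideanSpace.norm_eq]
  refine Real.sqrt_le_sqrt (Finset.sum_le_sum fun j _ => ?_)
  rw [Real.norm_eq_abs, Real.norm_eq_abs, PiLp.sub_apply]
  obtain ⟨h1, h2⟩ := hy j
  obtain ⟨h3, h4⟩ := hw j
  refine pow_le_pow_left₀ (abs_nonneg _) ?_ 2
  rw [abs_of_nonneg (h1.trans h2), abs_le]
  constructor <;> linarith

theorem norm_le_of_mem_dualBox (hw : w ∈ dualBox ybar) : ‖w‖ ≤ ‖ybar‖ := by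
  have h0 : (0 : Vec dy) ∈ dualBox ybar := fun j => ⟨le_rfl, (hw j).1.trans (hw j).2⟩
  simpa using norm_sub_le_of_mem_dualBox h0 hw

/-- The variational inequality that characterizes the projection onto `𝒴`. -/
theorem inner_sub_projBox_nonpos (hw : w ∈ dualBox ybar) (y : Vec dy) :
    inner ℝ (y - projBox ybar y) (w - projBox ybar y) ≤ 0 := by
  rw [PiLp.inner_apply]
  refine Finset.sum_nonpos fun j _ => ?_
  obtain ⟨h1, h2⟩ := hw j
  simp only [PiLp.sub_apply, projBox, RCLike.inner_apply, conj_trivial]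
  rcases le_total (y j) (ybar j) with h3 | h3
  · rw [min_eq_left h3]
    rcases le_total 0 (y j) with h4 | h4
    · rw [max_eq_right h4]; simp
    · rw [max_eq_left h4]; nlinarith
  · rw [min_eq_right h3, max_eq_right (h1.trans h2)]; nlinarith

/-- Used twice: with `w = y` it yields the dual ascent ‖y' - y‖²/β, and with arbitrary `w` it bounds
the duality gap by the dual displacement. -/
theorem inner_sub_projBox_step_le (hw : w ∈ dualBox ybar) (y v : Vec dy) (β : ℝ) :
    β * inner ℝ (w - projBox ybar (y + β • v)) v ≤
      inner ℝ (projBox ybar (y + β • v) - y) (w - projBox ybar (y + β • v)) := by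
  have h := inner_sub_projBox_nonpos hw (y + β • v)
  set q := projBox ybar (y + β • v)
  have h1 : y + β • v - q = β • v - (q - y) := by abel
  rw [h1, inner_sub_left, inner_smul_left, real_inner_comm] at h
  simpa using h

end Box

/-! ### Regularity of the Lagrangian and of Φ. -/

section Problem

variable {h : Vec dx → ℝ} {c : Vec dx → Vec dy} {ybar : Vec dy} {L : ℝ}

theorem lagrangian_sub (h : Vec dx → ℝ) (c : Vec dx → Vec dy) (x : Vec dx) (y y' : Vec dy) :
    lagrangian h c x y' - lagrangian h c x y = inner ℝ (y' - y) (c x) := by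
  simp only [lagrangian, inner_sub_left]; ring

theorem bddAbove_lagrangian (h : Vec dx → ℝ) (c : Vec dx → Vec dy) (ybar : Vec dy) (x : Vec dx) :
    BddAbove (lagrangian h c x '' dualBox ybar) := by
  refine ⟨h x + ‖ybar‖ * ‖c x‖, ?_⟩
  rintro _ ⟨w, hw, rfl⟩
  have h1 := real_inner_le_norm w (c x)
  have h2 := mul_le_mul_of_nonneg_right (norm_le_of_mem_dualBox hw) (norm_nonneg (c x))
  simp only [lagrangian]; linarith

theorem lagrangian_le_primalMax {y : Vec dy} (hy : y ∈ dualBox ybar) (x : Vec dx) :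
    lagrangian h c x y ≤ primalMax h c ybar x :=
  le_csSup (bddAbove_lagrangian h c ybar x) ⟨y, hy, rfl⟩

theorem primalMax_le {y : Vec dy} (hy : y ∈ dualBox ybar) {x : Vec dx} {M : ℝ}
    (hM : ∀ w ∈ dualBox ybar, lagrangian h c x w ≤ M) : primalMax h c ybar x ≤ M := by
  refine csSup_le ⟨_, y, hy, rfl⟩ ?_
  rintro _ ⟨w, hw, rfl⟩
  exact hM w hw

namespace IsSmooth

theorem norm_gradX_sub_le (hs : IsSmooth L h c ybar) (x₁ x₂ : Vec dx) {y₁ y₂ : Vec dy}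
    (h₁ : y₁ ∈ dualBox ybar) (h₂ : y₂ ∈ dualBox ybar) :
    ‖gradX h c x₁ y₁ - gradX h c x₂ y₂‖ ≤ L * (‖x₁ - x₂‖ + ‖y₁ - y₂‖) := by
  refine le_trans ?_ (hs.lipschitz x₁ x₂ y₁ h₁ y₂ h₂)
  rw [WithLp.prod_norm_eq_of_L2]
  exact Real.le_sqrt_of_sq_le (le_add_of_nonneg_right (sq_nonneg _))

theorem norm_constraint_sub_le (hs : IsSmooth L h c ybar) (x₁ x₂ : Vec dx) {y : Vec dy}
    (hy : y ∈ dualBox ybar) : ‖c x₁ - c x₂‖ ≤ L * ‖x₁ - x₂‖ := by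
  have h1 := hs.lipschitz x₁ x₂ y hy y hy
  rw [sub_self, norm_zero, add_zero, gradY_eq, gradY_eq] at h1
  refine le_trans ?_ h1
  rw [WithLp.prod_norm_eq_of_L2]
  exact Real.le_sqrt_of_sq_le (le_add_of_nonneg_left (sq_nonneg _))

theorem hasGradientAt (hs : IsSmooth L h c ybar) {y : Vec dy} (hy : y ∈ dualBox ybar)
    (x : Vec dx) : HasGradientAt (fun u => lagrangian h c u y) (gradX h c x y) x :=
  (hs.differentiable y hy x).hasGradientAt

theorem lagrangian_le (hs : IsSmooth L h c ybar) {y : Vec dy} (hy : y ∈ dualBox ybar)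
    (u v : Vec dx) :
    lagrangian h c u y ≤
      lagrangian h c v y + inner ℝ (gradX h c v y) (u - v) + L / 2 * ‖u - v‖ ^ 2 :=
  HasGradientAt.le_add_inner_add_sq (hs.hasGradientAt hy)
    (fun x₁ x₂ => by simpa using hs.norm_gradX_sub_le x₁ x₂ hy hy) u v

theorem le_lagrangian (hs : IsSmooth L h c ybar) {y : Vec dy} (hy : y ∈ dualBox ybar)
    (u v : Vec dx) :
    lagrangian h c v y + inner ℝ (gradX h c v y) (u - v) - L / 2 * ‖u - v‖ ^ 2 ≤
      lagrangian h c u y :=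
  HasGradientAt.add_inner_sub_sq_le (hs.hasGradientAt hy)
    (fun x₁ x₂ => by simpa using hs.norm_gradX_sub_le x₁ x₂ hy hy) u v

theorem continuous_lagrangian (hs : IsSmooth L h c ybar) {y : Vec dy} (hy : y ∈ dualBox ybar) :
    Continuous fun x => lagrangian h c x y :=
  (hs.differentiable y hy).continuous

/-- For fixed `y`, Φ - f(·, y) is a supremum of the functions ⟪w - y, c ·⟫, which are Lipschitz with
a common constant because `c` is Lipschitz and the box is bounded. -/
theorem continuous_primalMax (hs : IsSmooth L h c ybar) {y : Vec dy} (hy : y ∈ dualBox ybar) :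
    Continuous (primalMax h c ybar) := by
  have hL : ∀ x₁ x₂, primalMax h c ybar x₁ - lagrangian h c x₁ y ≤
      primalMax h c ybar x₂ - lagrangian h c x₂ y + ‖ybar‖ * L.toNNReal * dist x₁ x₂ := by
    intro x₁ x₂
    rw [sub_le_iff_le_add]
    refine primalMax_le hy fun w hw => ?_
    have h1 := lagrangian_le_primalMax (h := h) (c := c) hw x₂
    have h2 := lagrangian_sub h c x₁ y w
    have h3 := lagrangian_sub h c x₂ y w
    have h4 := real_inner_le_norm (w - y) (c x₁ - c x₂)
    rw [inner_sub_right] at h4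
    have h5 : ‖w - y‖ * ‖c x₁ - c x₂‖ ≤ ‖ybar‖ * (L.toNNReal * dist x₁ x₂) := by
      refine mul_le_mul (norm_sub_le_of_mem_dualBox hy hw) ?_ (norm_nonneg _) (norm_nonneg _)
      rw [dist_eq_norm]
      exact (hs.norm_constraint_sub_le x₁ x₂ hy).trans
        (mul_le_mul_of_nonneg_right (Real.le_coe_toNNReal L) (norm_nonneg _))
    linarith
  have h1 : LipschitzWith (‖ybar‖₊ * L.toNNReal)
      (fun x => primalMax h c ybar x - lagrangian h c x y) :=
    LipschitzWith.of_le_add_mul _ hL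
  exact (h1.continuous.add (hs.continuous_lagrangian hy)).congr fun x => sub_add_cancel _ _

end IsSmooth
end Problem
-- The potential, its bounds and the distance to the proximal point.
/-- The proximally regularized Lagrangian `K(x, z; y) = f(x, y) + p / 2 * ‖x - z‖ ^ 2`. -/
def smoothed (h : Vec dx → ℝ) (c : Vec dx → Vec dy) (p : ℝ) (y : Vec dy) (z x : Vec dx) : ℝ :=
  lagrangian h c x y + p / 2 * ‖x - z‖ ^ 2

/-- The gradient of `smoothed` in `x`. -/
def smoothedGrad (h : Vec dx → ℝ) (c : Vec dx → Vec dy) (p : ℝ) (y : Vec dy) (z x : Vec dx) :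
    Vec dx :=
  gradX h c x y + p • (x - z)

/-- The objective `Φ(x) + p / 2 * ‖x - z‖ ^ 2` of the proximal step on `Φ`. -/
def proxObjective (h : Vec dx → ℝ) (c : Vec dx → Vec dy) (ybar : Vec dy) (p : ℝ)
    (z x : Vec dx) : ℝ :=
  primalMax h c ybar x + p / 2 * ‖x - z‖ ^ 2

/-- The potential `K(x, z; y) - 2 min_u K(u, z; y) + 2 min_u (Φ(u) + p / 2 * ‖u - z‖ ^ 2)`. -/
def potential (h : Vec dx → ℝ) (c : Vec dx → Vec dy) (ybar : Vec dy) (p : ℝ)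
    (s : State dx dy) : ℝ :=
  smoothed h c p s.y s.z s.x - 2 * (⨅ u, smoothed h c p s.y s.z u)
    + 2 * ⨅ u, proxObjective h c ybar p s.z u

theorem iInf_eq_of_forall_le {ι : Type*} {f : ι → ℝ} {i : ι} (hi : ∀ j, f i ≤ f j) :
    ⨅ j, f j = f i :=
  le_antisymm (ciInf_le ⟨f i, by rintro _ ⟨j, rfl⟩; exact hi j⟩ i)
    (haveI : Nonempty ι := ⟨i⟩; le_ciInf hi)

/-- Moving z to z' changes the two envelopes in the potential by differences of squared distances;
combined, these collapse to one inner product. -/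
theorem norm_sub_sq_sub_norm_sub_sq (u v z z' : Vec dx) :
    ‖u - z'‖ ^ 2 - ‖u - z‖ ^ 2 - ‖v - z'‖ ^ 2 + ‖v - z‖ ^ 2 = 2 * inner ℝ (z' - z) (v - u) := by
  simp only [← real_inner_self_eq_norm_sq, inner_sub_left, inner_sub_right]
  rw [real_inner_comm u z', real_inner_comm u z, real_inner_comm v z', real_inner_comm v z]
  ring

namespace IsSmooth

variable {h : Vec dx → ℝ} {c : Vec dx → Vec dy} {ybar : Vec dy} {L : ℝ}

theorem strongFirstOrder_smoothed (hs : IsSmooth L h c ybar) {y : Vec dy}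
    (hy : y ∈ dualBox ybar) (p : ℝ) (z : Vec dx) :
    StrongFirstOrder (p - L) (smoothed h c p y z) (smoothedGrad h c p y z) :=
  strongFirstOrder_add_sq (hs.le_lagrangian hy) p z

theorem smoothedGrad_eq_zero (hs : IsSmooth L h c ybar) {y : Vec dy}
    (hy : y ∈ dualBox ybar) {p : ℝ} {z X : Vec dx}
    (hX : ∀ u, smoothed h c p y z X ≤ smoothed h c p y z u) : smoothedGrad h c p y z X = 0 :=
  ((hs.hasGradientAt hy X).add_sq p z).eq_zero_of_forall_le hX

theorem exists_smoothed_min (hs : IsSmooth L h c ybar) {y : Vec dy}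
    (hy : y ∈ dualBox ybar) {p : ℝ} (hp : L < p) (z : Vec dx) :
    ∃ X, ∀ u, smoothed h c p y z X ≤ smoothed h c p y z u := by
  refine (hs.strongFirstOrder_smoothed hy p z).exists_forall_le (sub_pos.2 hp) ?_
  have := hs.continuous_lagrangian hy
  unfold smoothed
  fun_prop

theorem exists_proxObjective_min (hs : IsSmooth L h c ybar) {y : Vec dy}
    (hy : y ∈ dualBox ybar) {p : ℝ} (hp : 0 < p) {flow : ℝ}
    (hflow : ∀ x, flow ≤ primalMax h c ybar x) (z : Vec dx) :
    ∃ X, ∀ u, proxObjective h c ybar p z X ≤ proxObjective h c ybar p z u := by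
  have hc : Continuous (proxObjective h c ybar p z) := by
    have := hs.continuous_primalMax hy
    unfold proxObjective
    fun_prop
  refine hc.exists_forall_le_of_isBounded z ?_
  -- The lower bound on Φ makes the objective coercive. The `+ 1` turns a bound on t² into one on t
  -- through t ≤ t² + 1.
  refine (Metric.isBounded_closedBall (x := z)
    (r := (primalMax h c ybar z - flow) / (p / 2) + 1)).subset fun u hu => ?_
  rw [mem_closedBall_iff_norm]
  have h1 : proxObjective h c ybar p z u ≤ proxObjective h c ybar p z z := hu
  simp only [proxObjective, sub_self, norm_zero] at h1
  have h2 := hflow u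
  have h3 : ‖u - z‖ ^ 2 ≤ (primalMax h c ybar z - flow) / (p / 2) := by
    rw [le_div_iff₀ (by positivity)]; nlinarith
  nlinarith [sq_nonneg (‖u - z‖ - 1)]

theorem smoothed_le (hs : IsSmooth L h c ybar) {y : Vec dy} (hy : y ∈ dualBox ybar)
    (p : ℝ) (z u v : Vec dx) :
    smoothed h c p y z u ≤ smoothed h c p y z v + inner ℝ (smoothedGrad h c p y z v) (u - v)
      + (p + L) / 2 * ‖u - v‖ ^ 2 := by
  have h0 := hs.lagrangian_le hy u v
  have h1 : ‖u - z‖ ^ 2 = ‖v - z‖ ^ 2 + 2 * inner ℝ (v - z) (u - v) + ‖u - v‖ ^ 2 := by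
    rw [← norm_add_sq_real]; congr 2; abel
  simp only [smoothed, smoothedGrad, inner_add_left, inner_smul_left, h1, RCLike.conj_to_real]
  linarith

/-- The potential never falls below a lower bound of `Φ`. -/
theorem le_potential (hs : IsSmooth L h c ybar) {p : ℝ} (hL : 0 < L) (hp : L < p) {flow : ℝ}
    (hflow : ∀ x, flow ≤ primalMax h c ybar x) {s : State dx dy} (hy : s.y ∈ dualBox ybar) :
    flow ≤ potential h c ybar p s := by
  obtain ⟨X, hX⟩ := hs.exists_smoothed_min hy hp s.z
  obtain ⟨Y, hY⟩ := hs.exists_proxObjective_min hy (hL.trans hp) hflow s.z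
  rw [potential, iInf_eq_of_forall_le hX, iInf_eq_of_forall_le hY]
  have h1 := hX s.x
  have h2 := hX Y
  have h3 := lagrangian_le_primalMax (h := h) (c := c) hy Y
  have h4 := hflow Y
  have h5 : 0 ≤ p / 2 * ‖Y - s.z‖ ^ 2 := by have := hL.trans hp; positivity
  simp only [proxObjective]
  simp only [smoothed] at h1 h2 ⊢
  linarith

theorem potential_init_le (hs : IsSmooth L h c ybar) {p : ℝ} (hL : 0 < L) (hp : L < p) {flow : ℝ}
    (hflow : ∀ x, flow ≤ primalMax h c ybar x) {x₀ : Vec dx} {y₀ : Vec dy}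
    (hy : y₀ ∈ dualBox ybar) :
    potential h c ybar p ⟨x₀, y₀, x₀⟩ ≤ primalMax h c ybar x₀
      + (primalMax h c ybar x₀ - lagrangian h c x₀ y₀) + ‖gradX h c x₀ y₀‖ ^ 2 / (p - L) := by
  obtain ⟨X, hX⟩ := hs.exists_smoothed_min hy hp x₀
  obtain ⟨Y, hY⟩ := hs.exists_proxObjective_min hy (hL.trans hp) hflow x₀
  rw [potential, iInf_eq_of_forall_le hX, iInf_eq_of_forall_le hY]
  have h1 := hY x₀
  have h2 := (hs.strongFirstOrder_smoothed hy p x₀).sub_le_norm_sq (sub_pos.2 hp) x₀ X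
  have h3 : smoothedGrad h c p y₀ x₀ x₀ = gradX h c x₀ y₀ := by simp [smoothedGrad]
  have h4 : smoothed h c p y₀ x₀ x₀ = lagrangian h c x₀ y₀ := by simp [smoothed]
  have h5 : proxObjective h c ybar p x₀ x₀ = primalMax h c ybar x₀ := by simp [proxObjective]
  have h6 : ‖gradX h c x₀ y₀‖ ^ 2 / (2 * (p - L)) * 2 = ‖gradX h c x₀ y₀‖ ^ 2 / (p - L) := by
    have := sub_pos.2 hp
    field_simp
  rw [h3, h4] at h2
  rw [h5] at h1
  simp only [h4]
  linarith

/-- How far the minimizer of `K(·, z; y)` is from the proximal point, in terms of the duality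
gap. -/
theorem sq_norm_sub_prox_le (hs : IsSmooth L h c ybar) {y : Vec dy} (hy : y ∈ dualBox ybar)
    {p M : ℝ} {z X Xs : Vec dx} (hX : ∀ u, smoothed h c p y z X ≤ smoothed h c p y z u)
    (hXs : ∀ u, proxObjective h c ybar p z Xs ≤ proxObjective h c ybar p z u)
    (hM : ∀ w ∈ dualBox ybar, inner ℝ (w - y) (c X) ≤ M) :
    (p - L) / 2 * ‖Xs - X‖ ^ 2 ≤ M := by
  -- The quadratic growth is that of K(·, z; y) around `X`; of `Xs` only minimality is used. The
  -- chain K(Xs) ≤ Φ-objective at `Xs` ≤ Φ-objective at `X` ≤ K(X) + M closes the estimate.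
  have h1 := (hs.strongFirstOrder_smoothed hy p z).quadratic_growth
    (hs.smoothedGrad_eq_zero hy hX) Xs
  have h2 := hXs X
  have h3 := lagrangian_le_primalMax (h := h) (c := c) hy Xs
  have h4 : primalMax h c ybar X ≤ lagrangian h c X y + M :=
    primalMax_le hy fun w hw => by
      have := lagrangian_sub h c X y w
      linarith [hM w hw]
  simp only [proxObjective] at h2
  simp only [smoothed] at h1
  linarith

theorem norm_smoothedGrad_sub_le (hs : IsSmooth L h c ybar) {y y' : Vec dy}
    (hy : y ∈ dualBox ybar) (hy' : y' ∈ dualBox ybar) (p : ℝ) (z x : Vec dx) :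
    ‖smoothedGrad h c p y' z x‖ ≤ ‖smoothedGrad h c p y z x‖ + L * ‖y' - y‖ := by
  have h1 := hs.norm_gradX_sub_le x x hy' hy
  rw [sub_self, norm_zero, zero_add] at h1
  have h2 : smoothedGrad h c p y' z x
      = smoothedGrad h c p y z x + (gradX h c x y' - gradX h c x y) := by
    simp only [smoothedGrad]; abel
  rw [h2]
  exact (norm_add_le _ _).trans (by linarith)

end IsSmooth
-- The block gradient estimator.
theorem inner_sum_smul_basisVec (I : Finset (Fin dx)) (g : Vec dx) (v : Fin dx → ℝ) :
    inner ℝ g (∑ i ∈ I, v i • basisVec i) = ∑ i ∈ I, g i * v i := by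
  rw [inner_sum]
  refine Finset.sum_congr rfl fun i _ => ?_
  simp [basisVec, inner_smul_right, EuclideanSpace.inner_single_right, mul_comm]

theorem norm_sq_sum_smul_basisVec (I : Finset (Fin dx)) (v : Fin dx → ℝ) :
    ‖∑ i ∈ I, v i • (basisVec i : Vec dx)‖ ^ 2 = ∑ i ∈ I, v i ^ 2 := by
  rw [← real_inner_self_eq_norm_sq, inner_sum_smul_basisVec]
  refine Finset.sum_congr rfl fun i hi => ?_
  have h1 : (∑ j ∈ I, v j • (basisVec j : Vec dx)) i = v i := by
    rw [WithLp.ofLp_sum, Finset.sum_apply, Finset.sum_eq_single_of_mem i hi]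
    · simp [basisVec]
    · intro j _ hj
      simp [basisVec, Ne.symm hj]
  rw [h1, sq]

namespace IsSmooth

variable {h : Vec dx → ℝ} {c : Vec dx → Vec dy} {ybar : Vec dy} {L : ℝ}

/-- Both sides of the descent lemma for the displacement r eᵢ, divided by `r`. -/
theorem abs_finiteDifference_sub_le (hs : IsSmooth L h c ybar) {y : Vec dy}
    (hy : y ∈ dualBox ybar) {r : ℝ} (hr : 0 < r) (x : Vec dx) (i : Fin dx) :
    |(lagrangian h c (x + r • basisVec i) y - lagrangian h c x y) / r - gradX h c x y i|
      ≤ L * r / 2 := by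
  have h1 := hs.lagrangian_le hy (x + r • basisVec i) x
  have h2 := hs.le_lagrangian hy (x + r • basisVec i) x
  have h3 : inner ℝ (gradX h c x y) (r • basisVec i) = r * gradX h c x y i := by
    simp [basisVec, inner_smul_right, EuclideanSpace.inner_single_right]
  have h4 : ‖r • (basisVec i : Vec dx)‖ = r := by
    simp [basisVec, norm_smul, abs_of_pos hr]
  rw [add_sub_cancel_left, h3, h4] at h1 h2
  have h5 : (lagrangian h c (x + r • basisVec i) y - lagrangian h c x y) / r - gradX h c x y i
      = (lagrangian h c (x + r • basisVec i) y - lagrangian h c x y - r * gradX h c x y i) / r := by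
    field_simp
  rw [h5, abs_div, abs_of_pos hr, div_le_iff₀ hr, abs_le]
  constructor <;> nlinarith

/-- Decrease of `K(·, z; y)` along one block step. -/
theorem smoothed_block_step_le (hs : IsSmooth L h c ybar) {y : Vec dy} (hy : y ∈ dualBox ybar)
    {p α r : ℝ} (hα₀ : 0 < α) (hα : α * (p + 10 * L + 1) ≤ 1)
    (hr : 0 < r) (I : Finset (Fin dx)) (x z : Vec dx) :
    smoothed h c p y z (x - α • blockEstimator h c p r I x y z) ≤ smoothed h c p y z x
      - α / 2 * ∑ i ∈ I, smoothedGrad h c p y z x i ^ 2 + α * I.card * L ^ 2 * r ^ 2 / 8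
      - (9 * L + 1) / 2 * ‖x - α • blockEstimator h c p r I x y z - x‖ ^ 2 := by
  set v : Fin dx → ℝ := fun i =>
    (lagrangian h c (x + r • basisVec i) y - lagrangian h c x y) / r + p * (x i - z i) with hv
  set g := smoothedGrad h c p y z x with hg
  have hest : blockEstimator h c p r I x y z = ∑ i ∈ I, v i • basisVec i := rfl
  have h1 := hs.smoothed_le hy p z (x - α • blockEstimator h c p r I x y z) x
  have h2 : x - α • blockEstimator h c p r I x y z - x
      = -(α • blockEstimator h c p r I x y z) := by abel
  have h3 : ‖α • blockEstimator h c p r I x y z‖ ^ 2 = α ^ 2 * ∑ i ∈ I, v i ^ 2 := by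
    rw [norm_smul, mul_pow, hest, norm_sq_sum_smul_basisVec, Real.norm_eq_abs, sq_abs]
  rw [h2, norm_neg, h3] at h1 ⊢
  rw [inner_neg_right, inner_smul_right, hest, inner_sum_smul_basisVec, ← hg] at h1
  have h4 : ∀ i, (v i - g i) ^ 2 ≤ L ^ 2 * r ^ 2 / 4 := by
    intro i
    have h5 := hs.abs_finiteDifference_sub_le hy hr x i
    have h6 : v i - g i =
        (lagrangian h c (x + r • basisVec i) y - lagrangian h c x y) / r - gradX h c x y i := by
      simp only [hv, hg, smoothedGrad, PiLp.add_apply, PiLp.smul_apply, PiLp.sub_apply,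
        smul_eq_mul]
      ring
    rw [h6, ← sq_abs]
    refine (pow_le_pow_left₀ (abs_nonneg _) h5 2).trans (le_of_eq ?_)
    ring
  have h7 : -(α * ∑ i ∈ I, g i * v i) + (p + L) / 2 * (α ^ 2 * ∑ i ∈ I, v i ^ 2)
      ≤ ∑ i ∈ I, (-(α / 2) * g i ^ 2 + α * (L ^ 2 * r ^ 2 / 8)
        - (9 * L + 1) / 2 * (α ^ 2 * v i ^ 2)) := by
    rw [Finset.mul_sum, Finset.mul_sum, Finset.mul_sum, ← Finset.sum_neg_distrib,
      ← Finset.sum_add_distrib]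
    -- Coordinatewise, -g v = ((v - g)² - g² - v²)/2. The step-size condition lets -αv²/2 pay for
    -- the curvature (p + L)α²v²/2 and leave (9L + 1)α²v²/2 over.
    refine Finset.sum_le_sum fun i _ => ?_
    have h8 := mul_le_mul_of_nonneg_left (h4 i) hα₀.le
    have h9 := mul_le_mul_of_nonneg_right hα (mul_nonneg hα₀.le (sq_nonneg (v i)))
    linarith
  rw [Finset.sum_sub_distrib, Finset.sum_add_distrib, Finset.sum_const, ← Finset.mul_sum,
    ← Finset.mul_sum, ← Finset.mul_sum, nsmul_eq_mul] at h7
  rw [hest]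
  linarith

end IsSmooth

/-! ### Descent of the potential in one step. -/

/-- The scalar estimate that combines the bounds on the parts of the potential along one step.
Here `q`, `D`, `e`, `u`, `E` and `ξ` stand for `‖∇ₓK(x, z; y)‖`, `‖y' - y‖`, `‖x' - x‖`,
`‖x' - z‖`, `‖x(y', z) - x*(z)‖` and `‖x - x(y', z)‖`. -/
theorem step_scalar_bound {L p α θ R N β γ q D e u E ξ : ℝ} (hL : 0 < L) (hp : 3 * L ≤ p)
    (hα₀ : 0 < α) (hα : α * (p + 10 * L + 1) ≤ 1) (hθ : 0 < θ) (hR : 0 ≤ R) (hN : 0 < N)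
    (hβ₀ : 0 < β) (hβN : θ ≤ β * N) (hβL : 12 * L * β ≤ 1)
    (hβα : 4 * L * N * β ≤ α ^ 2 * (p - L) ^ 2)
    (hγ₀ : 0 ≤ γ) (hγ : γ ≤ 1 / 36) (hq : 0 ≤ q) (hD : 0 ≤ D)
    (hξ : (p - L) * ξ ≤ q + L * D) (hE : (p - L) / 2 * E ^ 2 ≤ R * (D / β + L * ξ)) :
    p / 2 * ((1 - γ) ^ 2 - 1) * u ^ 2 + L * D * e - D ^ 2 / β + 2 * L * D * ξ
      + 2 * p * γ * (u * (E + 3 / 2 * (γ * u))) - (9 * L + 1) / 2 * e ^ 2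
    ≤ 3 * α / (8 * N) * q ^ 2 - D ^ 2 / (4 * β) - e ^ 2 / 2 - p * γ / 4 * u ^ 2
      + (49 * R ^ 2 / θ + 18 * R ^ 2 / α) * (N * γ ^ 2) := by
  set m := p - L with hm
  have hm2 : 2 * L ≤ m := by linarith
  have hm0 : 0 < m := by linarith
  have hpm : p ≤ 3 / 2 * m := by linarith
  have hp0 : 0 < p := by linarith
  obtain ⟨B, hB⟩ : ∃ B, B = 1 / β := ⟨_, rfl⟩
  have hB0 : 0 < B := by rw [hB]; positivity
  have hBβ : B * β = 1 := by rw [hB]; field_simp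
  have hDB : D / β = D * B := by rw [hB]; ring
  have hD2B : D ^ 2 / β = D ^ 2 * B := by rw [hB]; ring
  have hD4B : D ^ 2 / (4 * β) = D ^ 2 * B / 4 := by rw [hB]; ring
  have hLB : 12 * L ≤ B := by rw [hB, le_div_iff₀ hβ₀]; linarith
  have hBN : B ≤ N / θ := by
    rw [hB, div_le_div_iff₀ hβ₀ hθ]; linarith
  -- `L * ξ ≤ q / 2 + L * D / 2`, and its sharper form with `1 / m`
  have hξ' : ξ ≤ (q + L * D) / m := by rw [le_div_iff₀ hm0]; linarith
  have hξ2 : L * ξ ≤ L * q / m + L * D / 2 := by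
    have h1 : L * (L * D) / m ≤ L * D / 2 := by
      rw [div_le_div_iff₀ hm0 two_pos]
      linarith [mul_le_mul_of_nonneg_left hm2 (mul_nonneg hL.le hD)]
    calc L * ξ ≤ L * ((q + L * D) / m) := mul_le_mul_of_nonneg_left hξ' hL.le
      _ = L * q / m + L * (L * D) / m := by ring
      _ ≤ _ := by linarith
  have hLq : L * q / m ≤ q / 2 := by
    rw [div_le_div_iff₀ hm0 two_pos]; linarith [mul_le_mul_of_nonneg_right hm2 hq]
  have hLD : L * D ≤ D * B / 12 := by linarith [mul_le_mul_of_nonneg_left hLB hD]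
  -- the term with `D * ξ`
  have hDξ : 2 * L * D * ξ ≤ α / (4 * N) * q ^ 2 + D ^ 2 * B / 13 + D ^ 2 * B / 12 := by
    have h1 : 2 * L * D * ξ ≤ 2 * D * (L * q / m) + D * (D * B / 12) := by
      linarith [mul_le_mul_of_nonneg_left hξ2 hD, mul_le_mul_of_nonneg_left hLD hD]
    have h2 : 2 * D * (L * q / m) ≤ α / (4 * N) * q ^ 2 + 4 * N * L ^ 2 / (α * m ^ 2) * D ^ 2 := by
      have h3 : α / (4 * N) * q ^ 2 + 4 * N * L ^ 2 / (α * m ^ 2) * D ^ 2 - 2 * D * (L * q / m)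
          = (α * m * q - 4 * N * L * D) ^ 2 / (4 * N * α * m ^ 2) := by
        field_simp; ring
      have : 0 ≤ (α * m * q - 4 * N * L * D) ^ 2 / (4 * N * α * m ^ 2) := by positivity
      linarith
    have h4 : 4 * N * L ^ 2 / (α * m ^ 2) ≤ B / 13 := by
      -- The 13 comes from p + 10L + 1 ≥ 13L.
      have h5 : 13 * (α * L) ≤ 1 := by linarith [mul_le_mul_of_nonneg_left hp hα₀.le]
      have h6 : 4 * L * N ≤ B * (α ^ 2 * m ^ 2) := by
        calc 4 * L * N = B * (4 * L * N * β) := by linear_combination (-(4 * L * N)) * hBβ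
          _ ≤ _ := mul_le_mul_of_nonneg_left hβα hB0.le
      rw [div_le_iff₀ (by positivity)]
      have h7 := mul_le_mul_of_nonneg_left h6 hL.le
      have h8 := mul_le_mul_of_nonneg_left h5 (show 0 ≤ B * α * m ^ 2 by positivity)
      linarith
    have h9 := mul_le_mul_of_nonneg_right h4 (sq_nonneg D)
    linarith
  -- the error bound
  have hpE : 2 * p * γ * E ^ 2 ≤ 7 * γ * R * (D * B) + 3 * γ * R * q := by
    rw [hDB] at hE
    have h1 : p * E ^ 2 ≤ 3 / 2 * m * E ^ 2 := mul_le_mul_of_nonneg_right hpm (sq_nonneg E)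
    have h2 : R * (D * B + L * ξ) ≤ R * (7 / 6 * (D * B) + q / 2) := by
      refine mul_le_mul_of_nonneg_left ?_ hR
      have : 0 ≤ D * B := by positivity
      linarith
    have h3 : p * E ^ 2 ≤ 3 * (R * (7 / 6 * (D * B) + q / 2)) := by linarith
    have h4 := mul_le_mul_of_nonneg_left h3 hγ₀
    have h5 : 0 ≤ γ * (R * q) := by positivity
    linarith
  -- The error bound is linear in `D` and `q`, so completing squares here and in `hpq` produces the
  -- residual N γ²; `D` uses 1/β ≤ N/θ.
  have hpD : 7 * γ * R * (D * B) ≤ D ^ 2 * B / 4 + 49 * R ^ 2 / θ * (N * γ ^ 2) := by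
    have h1 : 49 * R ^ 2 * γ ^ 2 * B ≤ 49 * R ^ 2 * γ ^ 2 * (N / θ) :=
      mul_le_mul_of_nonneg_left hBN (by positivity)
    have h2 : 49 * R ^ 2 * γ ^ 2 * (N / θ) = 49 * R ^ 2 / θ * (N * γ ^ 2) := by ring
    have h3 : 0 ≤ B * (D / 2 - 7 * γ * R) ^ 2 := by positivity
    linarith
  have hpq : 3 * γ * R * q ≤ α / (8 * N) * q ^ 2 + 18 * R ^ 2 / α * (N * γ ^ 2) := by
    have h3 : α / (8 * N) * q ^ 2 + 18 * R ^ 2 / α * (N * γ ^ 2) - 3 * γ * R * q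
        = (α * q - 12 * N * γ * R) ^ 2 / (8 * N * α) := by
      field_simp; ring
    have : 0 ≤ (α * q - 12 * N * γ * R) ^ 2 / (8 * N * α) := by positivity
    linarith
  have huE : 2 * p * γ * (u * E) ≤ p * γ / 2 * u ^ 2 + 2 * p * γ * E ^ 2 := by
    have : 0 ≤ p * γ * (u - 2 * E) ^ 2 := by positivity
    linarith
  have hu : p / 2 * ((1 - γ) ^ 2 - 1) * u ^ 2 + p * γ / 2 * u ^ 2 + 3 * p * γ ^ 2 * u ^ 2
      ≤ -(p * γ / 4 * u ^ 2) := by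
    have h1 : γ * (p * γ * u ^ 2) ≤ 1 / 36 * (p * γ * u ^ 2) :=
      mul_le_mul_of_nonneg_right hγ (by positivity)
    have h2 : 0 ≤ p * γ * u ^ 2 := by positivity
    linarith
  have hDe : L * D * e ≤ D ^ 2 * B / 24 + L / 2 * e ^ 2 := by
    have h1 : 0 ≤ L * (D - e) ^ 2 := by positivity
    have h2 := mul_le_mul_of_nonneg_left hLD hD
    linarith
  have he : 0 ≤ L * e ^ 2 := by positivity
  have hDD : 0 ≤ D ^ 2 * B := by positivity
  have hsplit : 3 * α / (8 * N) * q ^ 2 = α / (4 * N) * q ^ 2 + α / (8 * N) * q ^ 2 := by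
    field_simp; ring
  rw [hD2B, hD4B, hsplit, add_mul]
  -- The D²/β terms cost 1/24 + 1/13 + 1/12 + 1/4 < 3/4, so at least 1/4 survives; of (9L + 1)/2 e²,
  -- at least 1/2 e² survives.
  linarith

namespace IsSmooth

variable {h : Vec dx → ℝ} {c : Vec dx → Vec dy} {ybar : Vec dy} {L : ℝ}

/-- Change of the potential along one step of the algorithm, for a fixed block. -/
theorem potential_step_le (hs : IsSmooth L h c ybar) {p α θ R N β γ r flow : ℝ}
    (hL : 0 < L) (hp : 3 * L ≤ p)
    (hα₀ : 0 < α) (hα : α * (p + 10 * L + 1) ≤ 1) (hθ : 0 < θ) (hR : ‖ybar‖ ≤ R) (hN : 0 < N)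
    (hβ₀ : 0 < β) (hβN : θ ≤ β * N) (hβL : 12 * L * β ≤ 1)
    (hβα : 4 * L * N * β ≤ α ^ 2 * (p - L) ^ 2) (hγ₀ : 0 ≤ γ) (hγ : γ ≤ 1 / 36) (hr : 0 < r)
    (hflow : ∀ x, flow ≤ primalMax h c ybar x) (I : Finset (Fin dx)) {s : State dx dy}
    (hy : s.y ∈ dualBox ybar) :
    potential h c ybar p (step h c ybar p α β γ r I s) ≤ potential h c ybar p s
      - α / 2 * ∑ i ∈ I, smoothedGrad h c p s.y s.z s.x i ^ 2
      + α * I.card * L ^ 2 * r ^ 2 / 8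
      + (3 * α / (8 * N) * ‖smoothedGrad h c p s.y s.z s.x‖ ^ 2
        - ‖(step h c ybar p α β γ r I s).y - s.y‖ ^ 2 / (4 * β)
        - ‖(step h c ybar p α β γ r I s).x - s.x‖ ^ 2 / 2
        - p * γ / 4 * ‖(step h c ybar p α β γ r I s).x - s.z‖ ^ 2
        + (49 * R ^ 2 / θ + 18 * R ^ 2 / α) * (N * γ ^ 2)) := by
  obtain ⟨x, y, z⟩ := s
  simp only [step] at hy ⊢
  set x' := x - α • blockEstimator h c p r I x y z with hx'
  set y' := projBox ybar (y + β • c x) with hy'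
  set z' := γ • x' + (1 - γ) • z with hz'
  have hpL : L < p := by linarith
  have hm : 0 < p - L := by linarith
  have hyb : y' ∈ dualBox ybar := projBox_mem hy _
  obtain ⟨X0, hX0⟩ := hs.exists_smoothed_min hy hpL z
  obtain ⟨X, hX⟩ := hs.exists_smoothed_min hyb hpL z
  obtain ⟨X', hX'⟩ := hs.exists_smoothed_min hyb hpL z'
  obtain ⟨Xs, hXs⟩ := hs.exists_proxObjective_min hy (hL.trans hpL) hflow z
  obtain ⟨Xs', hXs'⟩ := hs.exists_proxObjective_min hy (hL.trans hpL) hflow z'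
  simp only [potential]
  rw [iInf_eq_of_forall_le hX0, iInf_eq_of_forall_le hX', iInf_eq_of_forall_le hXs,
    iInf_eq_of_forall_le hXs']
  have hR0 : 0 ≤ R := (norm_nonneg _).trans hR
  have hzz : z' - z = γ • (x' - z) := by rw [hz']; module
  have hxz : x' - z' = (1 - γ) • (x' - z) := by rw [hz']; module
  -- the change of `K` in `x`
  have hKx := hs.smoothed_block_step_le hy hα₀ hα hr I x z
  rw [← hx'] at hKx
  -- the change of `K` in `z`
  have hKz : smoothed h c p y' z' x' = smoothed h c p y' z x'
      + p / 2 * ((1 - γ) ^ 2 - 1) * ‖x' - z‖ ^ 2 := by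
    simp only [smoothed, hxz, norm_smul, mul_pow, Real.norm_eq_abs, sq_abs]; ring
  have hyK : ∀ u, smoothed h c p y' z u = smoothed h c p y z u + inner ℝ (y' - y) (c u) := by
    intro u
    have := lagrangian_sub h c u y y'
    simp only [smoothed]; linarith
  -- the change of the two envelopes in `z`
  have hzΔ := norm_sub_sq_sub_norm_sub_sq Xs X' z z'
  have hPz := hXs' Xs
  have hψz : smoothed h c p y' z' X' = smoothed h c p y' z X'
      + p / 2 * (‖X' - z'‖ ^ 2 - ‖X' - z‖ ^ 2) := by simp only [smoothed]; ring
  have hPz' : proxObjective h c ybar p z' Xs = proxObjective h c ybar p z Xs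
      + p / 2 * (‖Xs - z'‖ ^ 2 - ‖Xs - z‖ ^ 2) := by simp only [proxObjective]; ring
  -- Each minimum is compared with a minimizer of another problem as test point, so no
  -- differentiability of the envelopes is needed.
  have hψy := hX X'
  have hψ0 := hX0 X
  have hyX := hyK X
  have hyx' := hyK x'
  -- distances between the minimizers
  have hgX := hs.smoothedGrad_eq_zero hyb hX
  have hXX : ‖X' - X‖ ≤ 3 / 2 * (γ * ‖x' - z‖) := by
    have h1 := (hs.strongFirstOrder_smoothed hyb p z').mul_norm_sub_le
      (hs.smoothedGrad_eq_zero hyb hX') X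
    have h2 : smoothedGrad h c p y' z' X = smoothedGrad h c p y' z X - p • (z' - z) := by
      simp only [smoothedGrad]; module
    rw [h2, hgX, zero_sub, norm_neg, hzz, smul_smul, norm_smul, Real.norm_eq_abs,
      abs_of_nonneg (by have := hL.trans hpL; positivity), norm_sub_rev] at h1
    have h3 : 0 ≤ γ * ‖x' - z‖ := by positivity
    refine le_of_mul_le_mul_left (h1.trans ?_) hm
    nlinarith
  have hξ : (p - L) * ‖x - X‖ ≤ ‖smoothedGrad h c p y z x‖ + L * ‖y' - y‖ :=
    ((hs.strongFirstOrder_smoothed hyb p z).mul_norm_sub_le hgX x).trans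
      (hs.norm_smoothedGrad_sub_le hy hyb p z x)
  -- The gap at `X` splits into the gap at `x`, controlled by the projection inequality, and a
  -- Lipschitz error in c(X) - c(x).
  have hE : (p - L) / 2 * ‖Xs - X‖ ^ 2 ≤ R * (‖y' - y‖ / β + L * ‖x - X‖) := by
    refine hs.sq_norm_sub_prox_le hyb hX hXs fun w hw => ?_
    have h1 := inner_sub_projBox_step_le hw y (c x) β
    rw [← hy'] at h1
    have h2 := real_inner_le_norm (y' - y) (w - y')
    have h3 := real_inner_le_norm (w - y') (c X - c x)
    have h4 := hs.norm_constraint_sub_le X x hy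
    rw [inner_sub_right] at h3
    rw [norm_sub_rev X x] at h4
    have h5 : ‖w - y'‖ ≤ R := (norm_sub_le_of_mem_dualBox hyb hw).trans hR
    have h6 : inner ℝ (w - y') (c x) ≤ R * (‖y' - y‖ / β) := by
      rw [← mul_div_assoc, le_div_iff₀ hβ₀]
      have := mul_le_mul_of_nonneg_left h5 (norm_nonneg (y' - y))
      linarith
    have h7 : ‖w - y'‖ * ‖c X - c x‖ ≤ R * (L * ‖x - X‖) :=
      mul_le_mul h5 h4 (norm_nonneg _) hR0
    linarith
  have hmain := step_scalar_bound (u := ‖x' - z‖) (e := ‖x' - x‖) hL hp hα₀ hα hθ hR0 hN hβ₀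
    hβN hβL hβα hγ₀ hγ (norm_nonneg _) (norm_nonneg _) hξ hE
  -- the inner products
  have hi1 : inner ℝ (z' - z) (X' - Xs) ≤
      γ * (‖x' - z‖ * (‖Xs - X‖ + 3 / 2 * (γ * ‖x' - z‖))) := by
    rw [hzz, inner_smul_left, RCLike.conj_to_real]
    refine mul_le_mul_of_nonneg_left ((real_inner_le_norm _ _).trans ?_) hγ₀
    refine mul_le_mul_of_nonneg_left ?_ (norm_nonneg _)
    have h1 : X' - Xs = (X' - X) - (Xs - X) := by abel
    rw [h1]
    exact (norm_sub_le _ _).trans (by linarith)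
  -- The change in `y` contributes ⟪y' - y, c x' - 2 c X⟫. Writing c x' - 2 c X = (c x' - c x) - c x
  -- + 2 (c x - c X), the middle part gives the ascent (`hi4`) and the others are Lipschitz errors.
  have hi2 : inner ℝ (y' - y) (c x') - inner ℝ (y' - y) (c x) ≤ L * ‖y' - y‖ * ‖x' - x‖ := by
    rw [← inner_sub_right]
    refine (real_inner_le_norm _ _).trans ?_
    have := mul_le_mul_of_nonneg_left (hs.norm_constraint_sub_le x' x hy) (norm_nonneg (y' - y))
    linarith
  have hi3 : inner ℝ (y' - y) (c x) - inner ℝ (y' - y) (c X) ≤ L * ‖y' - y‖ * ‖x - X‖ := by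
    rw [← inner_sub_right]
    refine (real_inner_le_norm _ _).trans ?_
    have := mul_le_mul_of_nonneg_left (hs.norm_constraint_sub_le x X hy) (norm_nonneg (y' - y))
    linarith
  have hi4 : ‖y' - y‖ ^ 2 / β ≤ inner ℝ (y' - y) (c x) := by
    have h1 := inner_sub_projBox_step_le hy y (c x) β
    rw [← hy', ← neg_sub y' y, inner_neg_left, inner_neg_right, real_inner_self_eq_norm_sq] at h1
    rw [div_le_iff₀ hβ₀]
    linarith
  have hi1' := mul_le_mul_of_nonneg_left hi1 (show 0 ≤ 2 * p by linarith)
  have hzΔ' := congrArg (fun t => p * t) hzΔ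
  linarith

end IsSmooth

/-! ### From descent to stationarity, for fixed blocks. -/

/-- The stationarity measure at `s`, bounded through the displacements of one step from `s`. -/
theorem norm_sq_proxGrad_le (h : Vec dx → ℝ) (c : Vec dx → Vec dy) (ybar : Vec dy)
    (p α β γ r : ℝ) (I : Finset (Fin dx)) (s : State dx dy) :
    ‖proxGrad h c ybar β s.x s.y‖ ^ 2 ≤ 2 * ‖smoothedGrad h c p s.y s.z s.x‖ ^ 2
      + 4 * p ^ 2 * (‖(step h c ybar p α β γ r I s).x - s.z‖ ^ 2
        + ‖(step h c ybar p α β γ r I s).x - s.x‖ ^ 2)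
      + ‖(step h c ybar p α β γ r I s).y - s.y‖ ^ 2 / β ^ 2 := by
  have sq_sub_le : ∀ u v : Vec dx, ‖u - v‖ ^ 2 ≤ 2 * ‖u‖ ^ 2 + 2 * ‖v‖ ^ 2 := fun u v => by
    have h1 := parallelogram_law_with_norm ℝ u v
    nlinarith [sq_nonneg ‖u + v‖]
  set x' := (step h c ybar p α β γ r I s).x
  have h1 : (step h c ybar p α β γ r I s).y = projBox ybar (s.y + β • c s.x) := rfl
  rw [h1, proxGrad, WithLp.prod_norm_sq_eq_of_L2]
  simp only [gradY_eq, WithLp.toLp_fst, WithLp.toLp_snd]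
  rw [norm_smul, norm_sub_rev s.y, mul_pow, Real.norm_eq_abs, sq_abs]
  have h2 : gradX h c s.x s.y
      = smoothedGrad h c p s.y s.z s.x - p • (s.x - s.z) := by simp [smoothedGrad]
  have h3 := sq_sub_le (smoothedGrad h c p s.y s.z s.x) (p • (s.x - s.z))
  have h4 := sq_sub_le (x' - s.z) (x' - s.x)
  rw [sub_sub_sub_cancel_left] at h4
  rw [norm_smul, mul_pow, Real.norm_eq_abs, sq_abs, ← h2] at h3
  have h5 := mul_le_mul_of_nonneg_left h4 (sq_nonneg p)
  have h6 : ∀ t : ℝ, (1 / β) ^ 2 * t = t / β ^ 2 := fun t => by ring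
  rw [h6]
  linarith

theorem iterate_y_mem {ybar : Vec dy} {h : Vec dx → ℝ} {c : Vec dx → Vec dy} {p α β γ : ℝ}
    {r : ℕ → ℝ} {x₀ : Vec dx} {y₀ : Vec dy} (hy : y₀ ∈ dualBox ybar)
    (I : ℕ → Finset (Fin dx)) (k : ℕ) :
    (iterate h c ybar p α β γ r x₀ y₀ I k).y ∈ dualBox ybar := by
  cases k with
  | zero => exact hy
  | succ k => exact projBox_mem hy _

/-- The k-th iterate sees only blocks 0, …, k - 1: the deterministic form of adaptedness, on which
independence and integrability rest. -/
theorem iterate_congr (h : Vec dx → ℝ) (c : Vec dx → Vec dy) (ybar : Vec dy) (p α β γ : ℝ)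
    (r : ℕ → ℝ) (x₀ : Vec dx) (y₀ : Vec dy) {I J : ℕ → Finset (Fin dx)} {k : ℕ}
    (hIJ : ∀ j < k, I j = J j) :
    iterate h c ybar p α β γ r x₀ y₀ I k = iterate h c ybar p α β γ r x₀ y₀ J k := by
  induction k with
  | zero => rfl
  | succ k ih =>
    rw [iterate, iterate, ih fun j hj => hIJ j (hj.trans k.lt_succ_self), hIJ k k.lt_succ_self]

/-- The weight that bounds `‖𝔤‖ ^ 2` by the decrease of the potential. -/
theorem norm_sq_proxGrad_le_mul (h : Vec dx → ℝ) (c : Vec dx → Vec dy) (ybar : Vec dy)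
    (p : ℝ) {α θ N β γ : ℝ} (hp : 0 ≤ p)
    (hα₀ : 0 < α) (hθ : 0 < θ) (hN : 0 < N) (hβ₀ : 0 < β) (hβN : θ ≤ β * N) (hγ₀ : 0 < γ) (r : ℝ)
    (I : Finset (Fin dx)) (s : State dx dy) :
    ‖proxGrad h c ybar β s.x s.y‖ ^ 2 ≤
      (16 * N / α + 16 * p / γ + 8 * p ^ 2 + 4 * N / θ) *
      (α / (8 * N) * ‖smoothedGrad h c p s.y s.z s.x‖ ^ 2
        + ‖(step h c ybar p α β γ r I s).y - s.y‖ ^ 2 / (4 * β)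
        + ‖(step h c ybar p α β γ r I s).x - s.x‖ ^ 2 / 2
        + p * γ / 4 * ‖(step h c ybar p α β γ r I s).x - s.z‖ ^ 2) := by
  refine (norm_sq_proxGrad_le h c ybar p α β γ r I s).trans ?_
  set q := ‖smoothedGrad h c p s.y s.z s.x‖ ^ 2
  set D := ‖(step h c ybar p α β γ r I s).y - s.y‖ ^ 2
  set e := ‖(step h c ybar p α β γ r I s).x - s.x‖ ^ 2
  set u := ‖(step h c ybar p α β γ r I s).x - s.z‖ ^ 2
  have hq : 0 ≤ q := sq_nonneg _
  have hD : 0 ≤ D := sq_nonneg _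
  have he : 0 ≤ e := sq_nonneg _
  have hu : 0 ≤ u := sq_nonneg _
  have ha : 0 ≤ 16 * N / α := by positivity
  have hb : 0 ≤ 16 * p / γ := by positivity
  have hc : 0 ≤ 8 * p ^ 2 := by positivity
  have hd : 0 ≤ 4 * N / θ := by positivity
  -- Each weight matches one displacement term; summing the weights gives a single factor for the
  -- whole decrease.
  have key : ∀ {A B C' D' a b c' d' : ℝ}, 0 ≤ A → 0 ≤ B → 0 ≤ C' → 0 ≤ D' → 0 ≤ a → 0 ≤ b →
      0 ≤ c' → 0 ≤ d' → A * a + B * b + C' * c' + D' * d' ≤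
        (A + B + C' + D') * (a + d' + c' + b) := by
    intro A B C' D' a b c' d' hA hB hC hD ha hb hc hd
    have h1 := mul_nonneg hA (add_nonneg (add_nonneg hd hc) hb)
    have h2 := mul_nonneg hB (add_nonneg (add_nonneg ha hd) hc)
    have h3 := mul_nonneg hC (add_nonneg (add_nonneg ha hd) hb)
    have h4 := mul_nonneg hD (add_nonneg (add_nonneg ha hc) hb)
    linarith
  refine le_trans ?_ (key ha hb hc hd (show 0 ≤ α / (8 * N) * q by positivity)
    (show 0 ≤ p * γ / 4 * u by positivity) (show 0 ≤ e / 2 by positivity)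
    (show 0 ≤ D / (4 * β) by positivity))
  have h1 : 16 * N / α * (α / (8 * N) * q) = 2 * q := by field_simp; ring
  have h2 : 16 * p / γ * (p * γ / 4 * u) = 4 * p ^ 2 * u := by field_simp; ring
  have h3 : D / β ^ 2 ≤ 4 * N / θ * (D / (4 * β)) := by
    have h4 : 4 * N / θ * (D / (4 * β)) - D / β ^ 2 = D * (β * N - θ) / (θ * β ^ 2) := by
      field_simp
    have h5 : 0 ≤ D * (β * N - θ) / (θ * β ^ 2) := by
      have := sub_nonneg.2 hβN
      positivity
    linarith
  rw [h1, h2]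
  linarith

namespace IsSmooth

variable {h : Vec dx → ℝ} {c : Vec dx → Vec dy} {ybar : Vec dy} {L : ℝ}

/-- The energy inequality along a run, for fixed blocks. -/
theorem sum_norm_sq_proxGrad_le (hs : IsSmooth L h c ybar) {p α θ R N β γ flow : ℝ} {b K : ℕ}
    (hL : 0 < L) (hp : 3 * L ≤ p)
    (hα₀ : 0 < α) (hα : α * (p + 10 * L + 1) ≤ 1) (hθ : 0 < θ) (hR : ‖ybar‖ ≤ R) (hN : 0 < N)
    (hβ₀ : 0 < β) (hβN : θ ≤ β * N) (hβL : 12 * L * β ≤ 1)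
    (hβα : 4 * L * N * β ≤ α ^ 2 * (p - L) ^ 2) (hγ₀ : 0 < γ) (hγ : γ ≤ 1 / 36)
    (hγK : K * N * γ ^ 2 ≤ 1) {r : ℕ → ℝ} (hr : ∀ k, 0 < r k)
    (hrK : b * ∑ k ∈ Finset.range (K + 1), r k ^ 2 ≤ 1)
    (hflow : ∀ x, flow ≤ primalMax h c ybar x) (I : ℕ → Finset (Fin dx))
    (hI : ∀ k, (I k).card = b) {x₀ : Vec dx} {y₀ : Vec dy} (hy : y₀ ∈ dualBox ybar)
    {s : ℕ → State dx dy} (hsI : ∀ k, s k = iterate h c ybar p α β γ r x₀ y₀ I k) :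
    (∑ k ∈ Finset.range K, ‖proxGrad h c ybar β (s k).x (s k).y‖ ^ 2)
        / (16 * N / α + 16 * p / γ + 8 * p ^ 2 + 4 * N / θ)
      ≤ potential h c ybar p ⟨x₀, y₀, x₀⟩ - flow + (49 * R ^ 2 / θ + 18 * R ^ 2 / α)
        + α * L ^ 2 / 8
        + α / 2 * ∑ k ∈ Finset.range K,
          (‖smoothedGrad h c p (s k).y (s k).z (s k).x‖ ^ 2 / N
            - ∑ i ∈ I k, smoothedGrad h c p (s k).y (s k).z (s k).x i ^ 2) := by
  set W := 16 * N / α + 16 * p / γ + 8 * p ^ 2 + 4 * N / θ with hW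
  have hp0 : 0 < p := by linarith
  have hW0 : 0 < W := by positivity
  have hsy : ∀ k, (s k).y ∈ dualBox ybar := fun k => hsI k ▸ iterate_y_mem hy I k
  have hstep : ∀ k, s (k + 1) = step h c ybar p α β γ (r k) (I k) (s k) := fun k => by
    rw [hsI, hsI, iterate]
  have h1 : ∀ k, ‖proxGrad h c ybar β (s k).x (s k).y‖ ^ 2 / W
      ≤ potential h c ybar p (s k) - potential h c ybar p (s (k + 1))
        + (49 * R ^ 2 / θ + 18 * R ^ 2 / α) * (N * γ ^ 2) + α * L ^ 2 / 8 * (b * r k ^ 2)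
        + α / 2 * (‖smoothedGrad h c p (s k).y (s k).z (s k).x‖ ^ 2 / N
            - ∑ i ∈ I k, smoothedGrad h c p (s k).y (s k).z (s k).x i ^ 2) := by
    intro k
    have h2 := hs.potential_step_le hL hp hα₀ hα hθ hR hN hβ₀ hβN hβL hβα hγ₀.le hγ (hr k) hflow
      (I k) (hsy k)
    have h3 := norm_sq_proxGrad_le_mul h c ybar p hp0.le hα₀ hθ hN hβ₀ hβN
      hγ₀ (r k) (I k) (s k)
    rw [← hW, ← div_le_iff₀' hW0] at h3
    rw [← hstep, hI] at h2
    rw [← hstep] at h3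
    -- Of the mean decrease α/(2N) ‖∇ₓK‖², three quarters absorb errors and one quarter is left to
    -- bound 𝔤; the deviation of the sampled sum from its mean is kept for the expectation.
    have h4 : ∀ t : ℝ, 3 * α / (8 * N) * t + α / (8 * N) * t = α / 2 * (t / N) := fun t => by
      field_simp; ring
    have h5 := h4 (‖smoothedGrad h c p (s k).y (s k).z (s k).x‖ ^ 2)
    linarith
  rw [Finset.sum_div]
  refine (Finset.sum_le_sum fun k _ => h1 k).trans ?_
  rw [Finset.sum_add_distrib, Finset.sum_add_distrib, Finset.sum_add_distrib,
    Finset.sum_range_sub', Finset.sum_const, Finset.card_range, ← Finset.mul_sum,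
    ← Finset.mul_sum, ← Finset.mul_sum, nsmul_eq_mul]
  have h2 := hs.le_potential hL (by linarith : L < p) hflow (hsy K)
  have h3 : s 0 = ⟨x₀, y₀, x₀⟩ := hsI 0
  have h4 : ∑ k ∈ Finset.range K, r k ^ 2 ≤ ∑ k ∈ Finset.range (K + 1), r k ^ 2 := by
    rw [Finset.sum_range_succ]; exact le_add_of_nonneg_right (sq_nonneg _)
  have h5 : α * L ^ 2 / 8 * (b * ∑ k ∈ Finset.range K, r k ^ 2) ≤ α * L ^ 2 / 8 * 1 :=
    mul_le_mul_of_nonneg_left ((mul_le_mul_of_nonneg_left h4 b.cast_nonneg).trans hrK)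
      (by positivity)
  have h6 : (49 * R ^ 2 / θ + 18 * R ^ 2 / α) * (K * N * γ ^ 2)
      ≤ (49 * R ^ 2 / θ + 18 * R ^ 2 / α) * 1 :=
    mul_le_mul_of_nonneg_left hγK (by positivity)
  rw [h3]
  linarith

end IsSmooth
-- Uniform block sampling and independence.
-- Remove the sets that avoid `i` by Pascal's rule, then use (n + 1) C(n, b) = C(n + 1, b + 1)(b +
-- 1).
theorem card_filter_mem_powersetCard {b : ℕ} (hb : 1 ≤ b) (i : Fin dx) :
    ((Finset.univ.powersetCard b).filter (i ∈ ·)).card * dx = dx.choose b * b := by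
  obtain ⟨b, rfl⟩ := Nat.exists_eq_add_of_le' hb
  obtain ⟨n, rfl⟩ : ∃ n, dx = n + 1 := ⟨dx - 1, by have := i.pos; omega⟩
  have h1 : (Finset.univ.powersetCard (b + 1)).filter (fun S : Finset (Fin (n + 1)) => i ∉ S)
      = (Finset.univ.erase i).powersetCard (b + 1) := by
    ext S
    simp only [Finset.mem_filter, Finset.mem_powersetCard, Finset.subset_erase,
      Finset.subset_univ, true_and]
    exact and_comm
  have h2 := Finset.card_filter_add_card_filter_not (s := Finset.univ.powersetCard (b + 1))
    (fun S : Finset (Fin (n + 1)) => i ∈ S)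
  rw [h1, Finset.card_powersetCard, Finset.card_powersetCard, Finset.card_erase_of_mem
    (Finset.mem_univ i), Finset.card_univ, Fintype.card_fin, Nat.add_sub_cancel,
    Nat.choose_succ_succ] at h2
  rw [Nat.add_right_cancel h2, mul_comm, Nat.add_one_mul_choose_eq]

theorem integrable_comp_of_finite {Ω κ : Type*} [MeasurableSpace Ω] {P : Measure Ω}
    [IsFiniteMeasure P] [MeasurableSpace κ] [Finite κ] [MeasurableSingletonClass κ]
    {X : Ω → κ} (hX : Measurable X) (F : κ → ℝ) : Integrable (fun ω => F (X ω)) P :=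
  (Integrable.of_finite (μ := P.map X) (f := F)).comp_measurable hX

namespace IsBlockSampling

variable {Ω : Type*} [MeasurableSpace Ω] {P : Measure Ω} {b : ℕ} {I : ℕ → Ω → Finset (Fin dx)}

theorem integral_comp [IsFiniteMeasure P] (hI : IsBlockSampling P b I) (k : ℕ)
    (F : Finset (Fin dx) → ℝ) :
    ∫ ω, F (I k ω) ∂P = (∑ S ∈ Finset.univ.powersetCard b, F S) / dx.choose b := by
  let _ : MeasurableSpace (Finset (Fin dx)) := ⊤
  have h1 : ∀ ω, F (I k ω) = ∑ S ∈ Finset.univ.powersetCard b,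
      {ω | I k ω = S}.indicator (fun _ => F S) ω := by
    intro ω
    rw [Finset.sum_eq_single_of_mem (I k ω)
      (Finset.mem_powersetCard.2 ⟨Finset.subset_univ _, hI.card_eq k ω⟩)]
    · simp
    · intro S _ hS
      simp [Ne.symm hS]
  have hm : ∀ S, MeasurableSet {ω | I k ω = S} := fun S =>
    hI.measurable k (MeasurableSpace.measurableSet_top (s := {S}))
  simp_rw [h1]
  rw [integral_finsetSum _ fun S _ => (integrable_const _).indicator (hm S), Finset.sum_div]
  refine Finset.sum_congr rfl fun S hS => ?_
  rw [integral_indicator_const _ (hm S), hI.uniform k S (Finset.mem_powersetCard.1 hS).2,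
    smul_eq_mul]
  ring

theorem integral_mem [IsFiniteMeasure P] (hI : IsBlockSampling P b I) (hb : 1 ≤ b) (hbd : b ≤ dx)
    (k : ℕ) (i : Fin dx) :
    ∫ ω, (if i ∈ I k ω then (1 : ℝ) else 0) ∂P = b / dx := by
  rw [hI.integral_comp k fun S => if i ∈ S then (1 : ℝ) else 0, Finset.sum_boole,
    div_eq_div_iff (Nat.cast_ne_zero.2 (Nat.choose_pos hbd).ne') (Nat.cast_ne_zero.2 i.pos.ne')]
  rw [mul_comm (b : ℝ)]
  exact_mod_cast card_filter_mem_powersetCard hb i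

theorem measurable_history (hI : IsBlockSampling P b I) (k : ℕ) :
    Measurable[_, MeasurableSpace.pi (m := fun _ => ⊤)]
      (fun ω (j : Finset.range k) => I j ω) :=
  @measurable_pi_lambda _ _ _ _ (fun _ => ⊤) _ fun j => hI.measurable j

/-- Functions of the first `k` blocks factor through a finite type. -/
theorem exists_eq_comp_history {β : Type*} {Ψ : (ℕ → Finset (Fin dx)) → β} {k : ℕ}
    (hΨ : ∀ J J' : ℕ → Finset (Fin dx), (∀ j < k, J j = J' j) → Ψ J = Ψ J') :
    ∃ T : (Finset.range k → Finset (Fin dx)) → β,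
      ∀ J : ℕ → Finset (Fin dx), Ψ J = T fun j => J j :=
  -- The filler ∅ for indices from `k` on is invisible to `Ψ`.
  ⟨fun H => Ψ fun j => if hj : j ∈ Finset.range k then H ⟨j, hj⟩ else ∅, fun J =>
    hΨ _ _ fun j hj => by simp [hj]⟩

theorem integrable_of_dependsOn [IsFiniteMeasure P] (hI : IsBlockSampling P b I)
    {Ψ : (ℕ → Finset (Fin dx)) → ℝ} {k : ℕ}
    (hΨ : ∀ J J' : ℕ → Finset (Fin dx), (∀ j < k, J j = J' j) → Ψ J = Ψ J') :
    Integrable (fun ω => Ψ fun j => I j ω) P := by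
  let _ : MeasurableSpace (Finset (Fin dx)) := ⊤
  obtain ⟨T, hT⟩ := exists_eq_comp_history hΨ
  simp_rw [hT]
  exact integrable_comp_of_finite (hI.measurable_history k) T

/-- The next block is independent of the functions of the previous ones. -/
theorem integral_mul_mem [IsFiniteMeasure P] (hI : IsBlockSampling P b I) (hb : 1 ≤ b)
    (hbd : b ≤ dx) {Ψ : (ℕ → Finset (Fin dx)) → ℝ} {k : ℕ}
    (hΨ : ∀ J J' : ℕ → Finset (Fin dx), (∀ j < k, J j = J' j) → Ψ J = Ψ J') (i : Fin dx) :
    ∫ ω, (Ψ fun j => I j ω) * (if i ∈ I k ω then (1 : ℝ) else 0) ∂P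
      = (∫ ω, (Ψ fun j => I j ω) ∂P) * (b / dx) := by
  let _ : MeasurableSpace (Finset (Fin dx)) := ⊤
  obtain ⟨T, hT⟩ := exists_eq_comp_history hΨ
  have h1 := hI.indep.indepFun_finset (Finset.range k) {k} (by simp) hI.measurable
  have h2 : IndepFun (fun ω => T fun j : Finset.range k => I j ω)
      (fun ω => if i ∈ I k ω then (1 : ℝ) else 0) P :=
    h1.comp (φ := T)
      (ψ := fun H : ({k} : Finset ℕ) → Finset (Fin dx) =>
        if i ∈ H ⟨k, Finset.mem_singleton_self k⟩ then (1 : ℝ) else 0)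
      (measurable_of_countable _) (measurable_of_countable _)
  simp_rw [hT]
  rw [h2.integral_fun_mul_eq_mul_integral, hI.integral_mem hb hbd]
  · exact (integrable_comp_of_finite (hI.measurable_history k) T).aestronglyMeasurable
  · exact (integrable_comp_of_finite (hI.measurable k)
      fun S => if i ∈ S then (1 : ℝ) else 0).aestronglyMeasurable

/-- In expectation, a sum over the next block is `b / dx` times the full sum. -/
theorem integral_sum_block [IsFiniteMeasure P] (hI : IsBlockSampling P b I) (hb : 1 ≤ b)
    (hbd : b ≤ dx) {Ψ : (ℕ → Finset (Fin dx)) → Fin dx → ℝ} {k : ℕ}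
    (hΨ : ∀ J J' : ℕ → Finset (Fin dx), (∀ j < k, J j = J' j) → Ψ J = Ψ J') :
    ∫ ω, ∑ i ∈ I k ω, Ψ (fun j => I j ω) i ∂P
      = ∫ ω, (∑ i, Ψ (fun j => I j ω) i) * (b / dx) ∂P := by
  have h0 : ∀ i, ∀ J J' : ℕ → Finset (Fin dx), (∀ j < k, J j = J' j) → Ψ J i = Ψ J' i :=
    fun i J J' hJ => congrFun (hΨ J J' hJ) i
  have h1 : ∀ ω, ∑ i ∈ I k ω, Ψ (fun j => I j ω) i
      = ∑ i, Ψ (fun j => I j ω) i * (if i ∈ I k ω then (1 : ℝ) else 0) := by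
    intro ω
    simp [Finset.sum_ite_mem]
  simp_rw [h1]
  rw [integral_mul_const, integral_finsetSum _ fun i _ => hI.integrable_of_dependsOn (h0 i),
    integral_finsetSum, Finset.sum_mul]
  · exact Finset.sum_congr rfl fun i _ => hI.integral_mul_mem hb hbd (h0 i) i
  · intro i _
    refine hI.integrable_of_dependsOn (k := k + 1)
      (Ψ := fun J => Ψ J i * (if i ∈ J k then (1 : ℝ) else 0)) fun J J' hJ => ?_
    rw [h0 i J J' fun j hj => hJ j (hj.trans k.lt_succ_self), hJ k k.lt_succ_self]

end IsBlockSampling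
-- Query count and bounds in expectation.
theorem queryCount_eq (h : Vec dx → ℝ) (c : Vec dx → Vec dy) (ybar : Vec dy) (p α β γ : ℝ)
    (r : ℕ → ℝ) (x₀ : Vec dx) (y₀ : Vec dy) {b : ℕ} {I : ℕ → Finset (Fin dx)}
    (hI : ∀ k, (I k).card = b) (K : ℕ) :
    queryCount h c ybar p α β γ r x₀ y₀ I K = K * (b + 1) := by
  simp [queryCount, stepQueries, hI]

theorem integral_le_of_integral_sq_le {Ω : Type*} [MeasurableSpace Ω] {P : Measure Ω}
    [IsProbabilityMeasure P] {X : Ω → ℝ} {ε : ℝ} (hε : 0 < ε) (hX : Integrable X P)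
    (hX2 : Integrable (fun ω => X ω ^ 2) P) (h : ∫ ω, X ω ^ 2 ∂P ≤ ε ^ 2) :
    ∫ ω, X ω ∂P ≤ ε := by
  -- Jensen for the square, through t ≤ t²/(2ε) + ε/2.
  have h1 : ∫ ω, X ω ∂P ≤ ∫ ω, (X ω ^ 2 / (2 * ε) + ε / 2) ∂P := by
    refine integral_mono hX ((hX2.div_const _).add (integrable_const _)) fun ω => ?_
    have h2 : X ω ^ 2 / (2 * ε) + ε / 2 - X ω = (X ω - ε) ^ 2 / (2 * ε) := by field_simp; ring
    have h3 : 0 ≤ (X ω - ε) ^ 2 / (2 * ε) := by positivity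
    simp only; linarith
  rw [integral_add (hX2.div_const _) (integrable_const _), integral_div, integral_const] at h1
  simp only [probReal_univ, one_smul] at h1
  have h2 : (∫ ω, X ω ^ 2 ∂P) / (2 * ε) ≤ ε / 2 := by
    rw [div_le_div_iff₀ (by positivity) two_pos]; nlinarith
  linarith

theorem IsSmooth.sum_integral_norm_sq_proxGrad_le {h : Vec dx → ℝ} {c : Vec dx → Vec dy}
    {ybar : Vec dy} {L : ℝ} (hs : IsSmooth L h c ybar) {p α θ R N β γ flow : ℝ} {b K : ℕ}
    (hL : 0 < L) (hp : 3 * L ≤ p)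
    (hα₀ : 0 < α) (hα : α * (p + 10 * L + 1) ≤ 1) (hθ : 0 < θ) (hR : ‖ybar‖ ≤ R)
    (hb : 1 ≤ b) (hbd : b ≤ dx) (hN : N = (dx : ℝ) / b)
    (hβ₀ : 0 < β) (hβN : θ ≤ β * N) (hβL : 12 * L * β ≤ 1)
    (hβα : 4 * L * N * β ≤ α ^ 2 * (p - L) ^ 2) (hγ₀ : 0 < γ) (hγ : γ ≤ 1 / 36)
    (hγK : K * N * γ ^ 2 ≤ 1) {r : ℕ → ℝ} (hr : ∀ k, 0 < r k)
    (hrK : b * ∑ k ∈ Finset.range (K + 1), r k ^ 2 ≤ 1)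
    (hflow : ∀ x, flow ≤ primalMax h c ybar x) {x₀ : Vec dx} {y₀ : Vec dy}
    (hy : y₀ ∈ dualBox ybar) {Ω : Type*} [MeasurableSpace Ω] {P : Measure Ω}
    [IsProbabilityMeasure P] {I : ℕ → Ω → Finset (Fin dx)} (hI : IsBlockSampling P b I)
    {s : (ℕ → Finset (Fin dx)) → ℕ → State dx dy}
    (hsI : s = iterate h c ybar p α β γ r x₀ y₀) :
    ∑ k ∈ Finset.range K, ∫ ω, ‖proxGrad h c ybar β (s (fun j => I j ω) k).x
        (s (fun j => I j ω) k).y‖ ^ 2 ∂P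
      ≤ (16 * N / α + 16 * p / γ + 8 * p ^ 2 + 4 * N / θ) *
        (potential h c ybar p ⟨x₀, y₀, x₀⟩ - flow + (49 * R ^ 2 / θ + 18 * R ^ 2 / α)
        + α * L ^ 2 / 8) := by
  have hdx : 0 < dx := by omega
  have hN0 : 0 < N := by rw [hN]; positivity
  have hsc : ∀ k, ∀ J J' : ℕ → Finset (Fin dx), (∀ j < k, J j = J' j) → s J k = s J' k :=
    fun k J J' hJ => by rw [hsI]; exact iterate_congr h c ybar p α β γ r x₀ y₀ hJ
  have hp0 : 0 < p := by linarith
  set W := 16 * N / α + 16 * p / γ + 8 * p ^ 2 + 4 * N / θ with hW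
  have hW0 : 0 < W := by positivity
  set C := potential h c ybar p ⟨x₀, y₀, x₀⟩ - flow + (49 * R ^ 2 / θ + 18 * R ^ 2 / α)
    + α * L ^ 2 / 8
  set g : (ℕ → Finset (Fin dx)) → ℕ → Vec dx := fun J k =>
    smoothedGrad h c p (s J k).y (s J k).z (s J k).x with hg
  have hgc : ∀ k, ∀ J J' : ℕ → Finset (Fin dx), (∀ j < k, J j = J' j) → g J k = g J' k :=
    fun k J J' hJ => by simp only [hg, hsc k J J' hJ]
  have hint1 : ∀ k, Integrable (fun ω => ‖proxGrad h c ybar β (s (fun j => I j ω) k).x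
      (s (fun j => I j ω) k).y‖ ^ 2) P := fun k =>
    hI.integrable_of_dependsOn (k := k)
      (Ψ := fun J => ‖proxGrad h c ybar β (s J k).x (s J k).y‖ ^ 2)
      fun J J' hJ => by rw [hsc k J J' hJ]
  have hint2 : ∀ k, Integrable (fun ω => ‖g (fun j => I j ω) k‖ ^ 2 / N) P := fun k =>
    hI.integrable_of_dependsOn (k := k) (Ψ := fun J => ‖g J k‖ ^ 2 / N)
      fun J J' hJ => by rw [hgc k J J' hJ]
  -- Here the dependence is on `k + 1` blocks, since block `k` itself is summed over.
  have hint3 : ∀ k, Integrable (fun ω => ∑ i ∈ I k ω, g (fun j => I j ω) k i ^ 2) P := fun k =>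
    hI.integrable_of_dependsOn (k := k + 1) (Ψ := fun J => ∑ i ∈ J k, g J k i ^ 2)
      fun J J' hJ => by
        rw [hgc k J J' fun j hj => hJ j (hj.trans k.lt_succ_self), hJ k k.lt_succ_self]
  have hmean : ∀ k, ∫ ω, ∑ i ∈ I k ω, g (fun j => I j ω) k i ^ 2 ∂P
      = ∫ ω, ‖g (fun j => I j ω) k‖ ^ 2 / N ∂P := by
    intro k
    rw [hI.integral_sum_block hb hbd (k := k) (Ψ := fun J i => g J k i ^ 2)
      fun J J' hJ => by rw [hgc k J J' hJ]]
    refine integral_congr_ae (Filter.Eventually.of_forall fun ω => ?_)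
    simp only [EuclideanSpace.real_norm_sq_eq, hN]
    field_simp
  have hpath : ∀ ω, (∑ k ∈ Finset.range K, ‖proxGrad h c ybar β (s (fun j => I j ω) k).x
      (s (fun j => I j ω) k).y‖ ^ 2) / W ≤ C + α / 2 * ∑ k ∈ Finset.range K,
        (‖g (fun j => I j ω) k‖ ^ 2 / N - ∑ i ∈ I k ω, g (fun j => I j ω) k i ^ 2) := fun ω =>
    hs.sum_norm_sq_proxGrad_le hL hp hα₀ hα hθ hR hN0 hβ₀ hβN hβL hβα hγ₀ hγ hγK hr hrK hflow
      (fun j => I j ω) (fun k => hI.card_eq k ω) hy fun k => by rw [hsI]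
  have hintsum : Integrable (fun ω => ∑ k ∈ Finset.range K,
      (‖g (fun j => I j ω) k‖ ^ 2 / N - ∑ i ∈ I k ω, g (fun j => I j ω) k i ^ 2)) P :=
    integrable_finsetSum _ fun k _ => (hint2 k).sub (hint3 k)
  have hzero : ∫ ω, ∑ k ∈ Finset.range K, (‖g (fun j => I j ω) k‖ ^ 2 / N
      - ∑ i ∈ I k ω, g (fun j => I j ω) k i ^ 2) ∂P = 0 := by
    rw [integral_finsetSum]
    · refine Finset.sum_eq_zero fun k _ => ?_
      rw [integral_sub (hint2 k) (hint3 k), hmean, sub_self]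
    · exact fun k _ => (hint2 k).sub (hint3 k)
  have hmono := integral_mono (μ := P) ((integrable_finsetSum _ fun k _ => hint1 k).div_const W)
    ((integrable_const C).add (hintsum.const_mul (α / 2))) hpath
  rw [integral_div, integral_finsetSum _ fun k _ => hint1 k] at hmono
  simp only [Pi.add_apply] at hmono
  rw [integral_add (integrable_const C) (hintsum.const_mul (α / 2)), integral_const_mul,
    hzero, integral_const, probReal_univ, one_smul, mul_zero, add_zero, div_le_iff₀ hW0] at hmono
  linarith

end ZOBSGDA

end

/-! ### Choice of the constants. -/

theorem corollary3
    -- the parameters on which the constants may depend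
    (L p α θ R Δ G : ℝ) (hL : 0 < L) (hp : 3 * L ≤ p)
    (hα₀ : 0 < α) (hα : α ≤ 1 / (p + 10 * L + 1)) (hθ : 0 < θ) :
    ∃ a₀ : ℝ, 0 < a₀ ∧ ∀ a : ℝ, 0 < a → a ≤ a₀ →
    ∃ C ε₀ : ℝ, 0 < C ∧ 0 < ε₀ ∧
    ∀ (dx b : ℕ), 1 ≤ b → b ≤ dx →
    ∀ ε : ℝ, 0 < ε → ε ≤ ε₀ →
    ∃ K : ℕ, 1 ≤ K ∧
    ∀ (N γ : ℝ), N = (dx : ℝ) / b → γ = a * ε ^ 2 / N →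
    -- the problem
    ∀ (dy : ℕ) (h : ZOBSGDA.Vec dx → ℝ) (c : ZOBSGDA.Vec dx → ZOBSGDA.Vec dy)
      (ybar : ZOBSGDA.Vec dy) (flow : ℝ),
    ‖ybar‖ ≤ R →
    (∀ x, flow ≤ ZOBSGDA.primalMax h c ybar x) →
    ZOBSGDA.IsSmooth L h c ybar →
    -- the initial point
    ∀ (x₀ : ZOBSGDA.Vec dx) (y₀ : ZOBSGDA.Vec dy), y₀ ∈ ZOBSGDA.dualBox ybar →
    ZOBSGDA.primalMax h c ybar x₀ - flow ≤ Δ →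
    ZOBSGDA.primalMax h c ybar x₀ - ZOBSGDA.lagrangian h c x₀ y₀ ≤ Δ →
    ‖ZOBSGDA.gradX h c x₀ y₀‖ ≤ G →
    -- the dual step size and the smoothing radii
    ∀ (β : ℝ) (r : ℕ → ℝ),
    θ / N ≤ β →
    β ≤ min (1 / (12 * L))
      (α ^ 2 * (p - L) ^ 2 / (4 * L * (Real.sqrt N + α * (p - L)) ^ 2)) →
    (∀ k, 0 < r k) →
    ∑ k ∈ Finset.range (K + 1), r k ^ 2 ≤ 1 / (b : ℝ) →
    -- the random blocks
    ∀ {Ω : Type*} [MeasurableSpace Ω] (P : MeasureTheory.Measure Ω)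
      [MeasureTheory.IsProbabilityMeasure P] (I : ℕ → Ω → Finset (Fin dx)),
    ZOBSGDA.IsBlockSampling P b I →
    γ ≤ min (Real.sqrt (1 / (K * N))) (min (1 / 36) (1 / (768 * p * β))) ∧
    (∀ ω, (ZOBSGDA.queryCount h c ybar p α β γ r x₀ y₀ (fun k => I k ω) K : ℝ)
      ≤ C * dx / ε ^ 4) ∧
    ∃ k < K,
      MeasureTheory.Integrable (fun ω =>
        ‖ZOBSGDA.proxGrad h c ybar β
          (ZOBSGDA.iterate h c ybar p α β γ r x₀ y₀ (fun j => I j ω) k).x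
          (ZOBSGDA.iterate h c ybar p α β γ r x₀ y₀ (fun j => I j ω) k).y‖) P ∧
      ∫ ω, ‖ZOBSGDA.proxGrad h c ybar β
          (ZOBSGDA.iterate h c ybar p α β γ r x₀ y₀ (fun j => I j ω) k).x
          (ZOBSGDA.iterate h c ybar p α β γ r x₀ y₀ (fun j => I j ω) k).y‖ ∂P ≤ ε := by
  have hpL : 0 < p - L := by linarith
  have hp0 : 0 < p := by linarith
  have hα1 : α * (p + 10 * L + 1) ≤ 1 := by
    rwa [le_div_iff₀ (by positivity)] at hα
  obtain ⟨W, hW⟩ : ∃ W, W = 16 / α + 16 * p + 8 * p ^ 2 + 4 / θ := ⟨_, rfl⟩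
  obtain ⟨B, hB⟩ : ∃ B, B = 2 * |Δ| + G ^ 2 / (p - L) + (49 * R ^ 2 / θ + 18 * R ^ 2 / α)
    + α * L ^ 2 / 8 := ⟨_, rfl⟩
  have hW0 : 0 < W := by rw [hW]; positivity
  have hB0 : 0 < B := by rw [hB]; positivity
  -- The average of E‖𝔤‖² will be at most 2aWBε², hence 2aWB ≤ 1.
  refine ⟨min 1 (1 / (2 * W * B)), by positivity, fun a ha ha' => ?_⟩
  have ha1 : a ≤ 1 := ha'.trans (min_le_left _ _)
  have haWB : a * (2 * W * B) ≤ 1 := by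
    rw [← le_div_iff₀ (by positivity)]; exact ha'.trans (min_le_right _ _)
  -- `C` comes from K(b + 1) ≤ 2Kb. The bound 1/6 gives γ ≤ 1/36; L/(64p) gives 64pγ ≤ L, hence
  -- 768pβγ ≤ 12Lβ ≤ 1.
  refine ⟨2 / a ^ 2, min (1 / 6) (L / (64 * p)), by positivity, by positivity,
    fun dx b hb hbd ε hε hε₀ => ?_⟩
  have hε6 : ε ≤ 1 / 6 := hε₀.trans (min_le_left _ _)
  have hεL : ε * (64 * p) ≤ L := by
    rw [← le_div_iff₀ (by positivity)]; exact hε₀.trans (min_le_right _ _)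
  have hb0 : (0 : ℝ) < b := by exact_mod_cast hb
  have hdx0 : (0 : ℝ) < dx := by exact_mod_cast hb.trans hbd
  have hN1 : 1 ≤ (dx : ℝ) / b := by rw [one_le_div hb0]; exact_mod_cast hbd
  have hδε : a * ε ^ 2 ≤ ε / 6 := by
    have h1 := mul_le_mul_of_nonneg_right ha1 (sq_nonneg ε)
    have h2 := mul_le_mul_of_nonneg_left hε6 hε.le
    linarith
  have hδ0 : 0 < a * ε ^ 2 := by positivity
  have hx1 : 1 ≤ (dx : ℝ) / b / (a * ε ^ 2) ^ 2 := by
    rw [one_le_div (by positivity)]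
    exact (pow_le_one₀ hδ0.le (by linarith)).trans hN1
  have hK1 : 1 ≤ ⌊(dx : ℝ) / b / (a * ε ^ 2) ^ 2⌋₊ := Nat.one_le_floor_iff _ |>.2 hx1
  -- The largest `K` with K N γ² ≤ 1. As the floored number is at least 1, the floor loses at most a
  -- factor 2.
  obtain ⟨K, hK⟩ : ∃ K, K = ⌊(dx : ℝ) / b / (a * ε ^ 2) ^ 2⌋₊ := ⟨_, rfl⟩
  rw [← hK] at hK1
  have hK1' : (1 : ℝ) ≤ K := by exact_mod_cast hK1
  have hKle : K * (a * ε ^ 2) ^ 2 ≤ (dx : ℝ) / b := by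
    rw [← le_div_iff₀ (by positivity), hK]; exact Nat.floor_le (by positivity)
  have hKge : (dx : ℝ) / b ≤ 2 * K * (a * ε ^ 2) ^ 2 := by
    rw [← div_le_iff₀ (by positivity)]
    have h1 := Nat.lt_floor_add_one ((dx : ℝ) / b / (a * ε ^ 2) ^ 2)
    rw [← hK] at h1
    linarith
  refine ⟨K, hK1, ?_⟩
  intro N γ hN hγ dy h c ybar flow hR hflow hs x₀ y₀ hy hΔ₁ hΔ₂ hG β r hβ₁ hβ₂ hr hrK Ω _ P _ I hI
  rw [← hN] at hN1 hKle hKge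
  have hN0 : 0 < N := by linarith
  have hγ0 : 0 < γ := by rw [hγ]; positivity
  have hγN : γ * N = a * ε ^ 2 := by rw [hγ]; field_simp
  have hγle : γ ≤ a * ε ^ 2 := hγN ▸ le_mul_of_one_le_right hγ0.le hN1
  have hβ0 : 0 < β := lt_of_lt_of_le (by positivity) hβ₁
  have hβN : θ ≤ β * N := by rwa [div_le_iff₀ hN0] at hβ₁
  have hβL : 12 * L * β ≤ 1 := by
    have h1 := hβ₂.trans (min_le_left _ _)
    rw [le_div_iff₀ (by positivity)] at h1
    linarith
  have hβα : 4 * L * N * β ≤ α ^ 2 * (p - L) ^ 2 := by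
    have h1 := hβ₂.trans (min_le_right _ _)
    rw [le_div_iff₀ (by positivity)] at h1
    refine le_trans ?_ h1
    have h2 : N ≤ (Real.sqrt N + α * (p - L)) ^ 2 := by
      have h3 : 0 ≤ α * (p - L) := by positivity
      linarith [Real.sq_sqrt hN0.le, mul_nonneg (Real.sqrt_nonneg N) h3,
        sq_nonneg (α * (p - L))]
    have h4 := mul_le_mul_of_nonneg_left h2 (show 0 ≤ 4 * L * β by positivity)
    linarith
  have hγ36 : γ ≤ 1 / 36 := by linarith
  have hγK : K * N * γ ^ 2 ≤ 1 := by
    have h1 : K * N * γ ^ 2 * N = K * (a * ε ^ 2) ^ 2 := by rw [← hγN]; ring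
    refine le_of_mul_le_mul_right ?_ hN0
    rw [h1, one_mul]; exact hKle
  refine ⟨le_min (Real.le_sqrt_of_sq_le ?_) (le_min hγ36 ?_), fun ω => ?_, ?_⟩
  · rw [le_div_iff₀ (by positivity)]; linarith
  · rw [le_div_iff₀ (by positivity)]
    have h1 : γ * p * 64 ≤ L := by
      have h2 : γ * (p * 64) ≤ ε * (p * 64) :=
        mul_le_mul_of_nonneg_right (by linarith) (by positivity)
      linarith
    have h3 := mul_le_mul_of_nonneg_right h1 (show 0 ≤ 12 * β by positivity)
    linarith
  · rw [ZOBSGDA.queryCount_eq h c ybar p α β γ r x₀ y₀ (fun k => hI.card_eq k ω)]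
    push_cast
    rw [le_div_iff₀ (by positivity), div_mul_eq_mul_div, le_div_iff₀ (by positivity)]
    have h1 : (K : ℝ) * (a * ε ^ 2) ^ 2 * b ≤ dx := by
      have h2 := mul_le_mul_of_nonneg_right hKle hb0.le
      rwa [hN, div_mul_cancel₀ _ hb0.ne'] at h2
    have h3 : (1 : ℝ) ≤ b := by exact_mod_cast hb
    have h4 := mul_le_mul_of_nonneg_left h3 (show 0 ≤ (K : ℝ) * (a * ε ^ 2) ^ 2 by positivity)
    linarith
  · have hrK' : b * ∑ k ∈ Finset.range (K + 1), r k ^ 2 ≤ 1 := by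
      rwa [le_div_iff₀ hb0, mul_comm] at hrK
    have hsum := hs.sum_integral_norm_sq_proxGrad_le hL hp hα₀ hα1 hθ hR hb hbd hN hβ0 hβN hβL hβα
      hγ0 hγ36 hγK hr hrK' hflow (x₀ := x₀) hy hI rfl
    have hpot := hs.potential_init_le hL (by linarith : L < p) hflow (x₀ := x₀) hy
    have hG2 : ‖ZOBSGDA.gradX h c x₀ y₀‖ ^ 2 / (p - L) ≤ G ^ 2 / (p - L) :=
      div_le_div_of_nonneg_right (pow_le_pow_left₀ (norm_nonneg _) hG 2) hpL.le
    have hBle : ZOBSGDA.potential h c ybar p ⟨x₀, y₀, x₀⟩ - flow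
        + (49 * R ^ 2 / θ + 18 * R ^ 2 / α) + α * L ^ 2 / 8 ≤ B := by
      rw [hB]; linarith [le_abs_self Δ]
    -- The term 16p/γ has order N/(aε²) exactly; the other terms are dominated because aε² ≤ 1 ≤ N.
    have hWle : 16 * N / α + 16 * p / γ + 8 * p ^ 2 + 4 * N / θ ≤ N / (a * ε ^ 2) * W := by
      have h1 : N ≤ N / (a * ε ^ 2) := by
        rw [le_div_iff₀ hδ0]; exact mul_le_of_le_one_right hN0.le (by linarith)
      have h2 : 16 * p / γ = N / (a * ε ^ 2) * (16 * p) := by rw [hγ]; field_simp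
      have h3 : 16 * N / α ≤ N / (a * ε ^ 2) * (16 / α) := by
        rw [mul_comm 16, mul_div_assoc]
        exact mul_le_mul_of_nonneg_right h1 (by positivity)
      have h4 : 4 * N / θ ≤ N / (a * ε ^ 2) * (4 / θ) := by
        rw [mul_comm 4, mul_div_assoc]
        exact mul_le_mul_of_nonneg_right h1 (by positivity)
      have h5 : 8 * p ^ 2 ≤ N / (a * ε ^ 2) * (8 * p ^ 2) :=
        le_mul_of_one_le_left (by positivity) (hN1.trans h1)
      rw [hW, h2]
      linarith
    have htotal : N / (a * ε ^ 2) * W * B ≤ K * ε ^ 2 := by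
      rw [div_mul_eq_mul_div, div_mul_eq_mul_div, div_le_iff₀ hδ0]
      have h1 := mul_le_mul_of_nonneg_right hKge (mul_nonneg hW0.le hB0.le)
      have h2 := mul_le_mul_of_nonneg_left haWB (show 0 ≤ (K : ℝ) * a * ε ^ 4 by positivity)
      linarith
    have hbound := (hsum.trans (mul_le_mul_of_nonneg_left hBle (by positivity))).trans
      ((mul_le_mul_of_nonneg_right hWle hB0.le).trans htotal)
    have hconst : (K : ℝ) * ε ^ 2 = ∑ _k ∈ Finset.range K, ε ^ 2 := by simp
    rw [hconst] at hbound
    obtain ⟨k, hk, hkε⟩ := Finset.exists_le_of_sum_le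
      (Finset.nonempty_range_iff.2 (by omega)) hbound
    have hdep : ∀ J J' : ℕ → Finset (Fin dx), (∀ j < k, J j = J' j) →
        ZOBSGDA.iterate h c ybar p α β γ r x₀ y₀ J k
          = ZOBSGDA.iterate h c ybar p α β γ r x₀ y₀ J' k :=
      fun J J' hJ => ZOBSGDA.iterate_congr h c ybar p α β γ r x₀ y₀ hJ
    have hint := hI.integrable_of_dependsOn (k := k)
      (Ψ := fun J => ‖ZOBSGDA.proxGrad h c ybar β
        (ZOBSGDA.iterate h c ybar p α β γ r x₀ y₀ J k).x
        (ZOBSGDA.iterate h c ybar p α β γ r x₀ y₀ J k).y‖)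
      fun J J' hJ => by simp only [hdep J J' hJ]
    have hint2 := hI.integrable_of_dependsOn (k := k)
      (Ψ := fun J => ‖ZOBSGDA.proxGrad h c ybar β
        (ZOBSGDA.iterate h c ybar p α β γ r x₀ y₀ J k).x
        (ZOBSGDA.iterate h c ybar p α β γ r x₀ y₀ J k).y‖ ^ 2)
      fun J J' hJ => by simp only [hdep J J' hJ]
    exact ⟨k, Finset.mem_range.1 hk, hint,
      ZOBSGDA.integral_le_of_integral_sq_le hε hint hint2 hkε⟩
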